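/- Let $2\le v\le 3$ and $0\le r\le v$, and let $\mathcal A_v$ (the quaternions for $v=2$, the octonions for $v=3$) and $\mathcal A_r$ be the real Cayley–Dickson algebras with standard generators $i_0=1,i_1,\dots$. Let $R_0$ be an (associative) real Banach algebra with unit $I$, $\|I\|=1$, $\|AB\|\le\|A\|\,\|B\|$. Let $R=\bigoplus_{j=0}^{2^v-1}R_0\,i_j$ be the corresponding algebra over $\mathcal A_v$, in which the generators $i_j$ commute with the elements of $R_0$, with norm $\|A\|^2=\sum_j\|A_j\|^2$; assume that $R$ is alternative, i.e. $(AA)B=A(AB)$ and $B(AA)=(BA)A$ for all $A,B\in R$. Let $R_{\mathbf C_{\mathbf i}}=R\oplus R\,\mathbf i$ be its complexification, where $\mathbf i^2=-1$ and $\mathbf i$ commutes with $R$, with $\|A+B\mathbf i\|^2=\|A\|^2+\|B\|^2$, and let $\mathbf C_{\mathbf i}=\mathbf R\oplus\mathbf R\,\mathbf i$. For $\beta=\sum_j\beta_ji_j$ and $t=\sum_jt_ji_j$ in $\mathcal A_r$ put $(\beta,t)=\mathrm{Re}(\beta t^*)=\sum_{j=0}^{2^r-1}\beta_jt_j$, and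 let $\lambda$ be Lebesgue measure on $\mathcal A_r\cong\mathbf R^{2^r}$. A left inverse of $x\in R_{\mathbf C_{\mathbf i}}$ is an element $z\in R_{\mathbf C_{\mathbf i}}$ with $zx=I$. (1) Let $a_n\in R$ and $\beta(n)\in\mathcal A_r$ ($n\in\mathbf N$) with $\sum_n\|a_n\|<\infty$, and let $x(t)=\sum_na_ne^{(\beta(n),t)\mathbf i}$ for $t\in\mathcal A_r$. If every $x(t)$ has a left inverse $z(t)$ in $R_{\mathbf C_{\mathbf i}}$ such that $\sup_t\|z(t)\|<\infty$, then there are $b_n\in R$ and $\tau(n)\in\mathcal A_r$ with $\sum_n\|b_n\|<\infty$ such that $y(t)=\sum_nb_ne^{(\tau(n),t)\mathbf i}$ satisfies $y(t)x(t)=I$ for all $t\in\mathcal A_r$. (2) Let $a:\mathcal A_r\to R$ be strongly (Bochner) integrable, $\int_{\mathcal A_r}\|a(\beta)\|\,\lambda(d\beta)<\infty$, and let $c\in\mathbf C_{\mathbf i}\setminus\{0\}$. If $x(t)=cI+\int_{\mathcal A_r}a(\beta)e^{(\beta,t)\mathbf i}\lambda(d\beta)$ has a left inverse in $R_{\mathbf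 C_{\mathbf i}}$ for every $t\in\mathcal A_r$, then there are $q\in\mathbf C_{\mathbf i}$ and a strongly integrable $b:\mathcal A_r\to R_{\mathbf C_{\mathbf i}}$, $\int_{\mathcal A_r}\|b(\beta)\|\,\lambda(d\beta)<\infty$, such that $y(t)=qI+\int_{\mathcal A_r}b(\beta)e^{(\beta,t)\mathbf i}\lambda(d\beta)$ satisfies $y(t)x(t)=I$ for all $t\in\mathcal A_r$. If moreover $c$ is real, then $q$ can be taken real and $b$ can be taken with values in $R$. -/

import Mathlib

open MeasureTheory

/-- `+1` for the generator `i_0 = 1`, `-1` for every imaginary generator: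
`(i_q)^* = cdConjSign q * i_q`. -/
def cdConjSign (q : ℕ) : ℤ := if q = 0 then 1 else -1

/-- The signs of the Cayley-Dickson algebra `𝒜_v` with standard generators `i_0, …, i_{2^v-1}`:
`i_p * i_q = cdSign v p q * i_{p xor q}` for `p, q < 2^v`. The recursion is the doubling procedure
`(a + b l) (c + d l) = (a c - d^* b) + (d a + b c^*) l` with `l = i_{2^v}` and
`i_{2^v + p} = i_p l`. -/
def cdSign : ℕ → ℕ → ℕ → ℤ
  | 0, _, _ => 1
  | v + 1, p, q =>
    if p < 2 ^ v then
      if q < 2 ^ v then cdSign v p q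
      else cdSign v (q - 2 ^ v) p
    else
      if q < 2 ^ v then cdConjSign q * cdSign v (p - 2 ^ v) q
      else -(cdConjSign (q - 2 ^ v) * cdSign v (q - 2 ^ v) (p - 2 ^ v))

/-- The Cayley-Dickson algebra `⨁_{j < 2^v} S i_j` with coefficients in `S`, where the generators
commute with the coefficients. Its norm is `‖A‖² = ∑ j, ‖A_j‖²`. For `S = ℝ` it is `𝒜_v`, with
its Euclidean norm and (as `volume`) its Lebesgue measure. -/
abbrev CayleyDickson (v : ℕ) (S : Type*) : Type _ := PiLp 2 (fun _ : Fin (2 ^ v) => S)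

namespace CayleyDickson

variable {v : ℕ} {S : Type*}

noncomputable instance [NormedRing S] : One (CayleyDickson v S) :=
  ⟨WithLp.toLp 2 fun k => if (k : ℕ) = 0 then 1 else 0⟩

/-- `(∑ x_p i_p) (∑ y_q i_q) = ∑ (x_p y_q) (i_p i_q)`: the pairs `p, q` that contribute to the
coefficient of `i_k` are those with `q = p xor k`. -/
noncomputable instance [NormedRing S] : Mul (CayleyDickson v S) :=
  ⟨fun x y => WithLp.toLp 2 fun k =>
    ∑ p : Fin (2 ^ v), cdSign v p (p ^^^ k : Fin (2 ^ v)) • (x p * y (p ^^^ k))⟩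

/-- `(β, t) = Re (β t^*) = β_0 t_0 + … + β_m t_m` on `𝒜_r`, `m = 2^r - 1`. -/
noncomputable def pairing {r : ℕ} (β t : CayleyDickson r ℝ) : ℝ := ∑ j, β j * t j

/-- The character `e^{(β, t) 𝐢}` of `(𝒜_r, +)`. -/
noncomputable def character {r : ℕ} (β t : CayleyDickson r ℝ) : ℂ :=
  Complex.exp ((pairing β t : ℂ) * Complex.I)

end CayleyDickson

/-- The multiplication of `R` is alternative. -/
def IsAlternativeMul (R : Type*) [Mul R] : Prop :=
  ∀ A B : R, (A * A) * B = A * (A * B) ∧ B * (A * A) = (B * A) * A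

/-- The complexification `R ⊕ R 𝐢`, with `‖A + B 𝐢‖² = ‖A‖² + ‖B‖²`; the element `A + B 𝐢` is
`Complexified.mk A B`. -/
def Complexified (R : Type*) : Type _ := WithLp 2 (R × R)

namespace Complexified

variable {R : Type*}

/-- The element `A + B 𝐢`. -/
def mk (A B : R) : Complexified R := WithLp.toLp 2 (A, B)

/-- The component `A` of `A + B 𝐢`. -/
def fst (X : Complexified R) : R := (WithLp.ofLp X).1

/-- The component `B` of `A + B 𝐢`. -/
def snd (X : Complexified R) : R := (WithLp.ofLp X).2

noncomputable instance [NormedAddCommGroup R] : NormedAddCommGroup (Complexified R) :=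
  inferInstanceAs (NormedAddCommGroup (WithLp 2 (R × R)))

noncomputable instance [NormedAddCommGroup R] [NormedSpace ℝ R] :
    NormedSpace ℝ (Complexified R) :=
  inferInstanceAs (NormedSpace ℝ (WithLp 2 (R × R)))

instance [NormedAddCommGroup R] [CompleteSpace R] : CompleteSpace (Complexified R) :=
  inferInstanceAs (CompleteSpace (WithLp 2 (R × R)))

/-- The inclusion `A ↦ A + 0 𝐢`. -/
def of [Zero R] (A : R) : Complexified R := mk A 0

instance [Zero R] [One R] : One (Complexified R) := ⟨of 1⟩

/-- `𝐢² = -1` and `𝐢` commutes with `R`. -/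
instance [Mul R] [Add R] [Sub R] : Mul (Complexified R) :=
  ⟨fun X Y => mk (X.fst * Y.fst - X.snd * Y.snd) (X.fst * Y.snd + X.snd * Y.fst)⟩

/-- Multiplication by the complex number `z = Re z + (Im z) 𝐢`. -/
noncomputable instance [NormedAddCommGroup R] [NormedSpace ℝ R] : SMul ℂ (Complexified R) :=
  ⟨fun z X => mk (z.re • X.fst - z.im • X.snd) (z.re • X.snd + z.im • X.fst)⟩

end Complexified

/-!
The proof is a local version of Wiener's theorem on the inversion of absolutely convergent series of
characters and of Fourier transforms, in a one-sided, operator-valued form; no Gelfand theory is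
involved.

*Reduction to an associative algebra.* The complexification of `R` need not be associative, but its
right multiplication operators lie in an associative complex Banach algebra. If `z x = 1` then
`(u z) x = u` for every `u` (`Complexified.mul_mul_cancel`). For quaternions this is associativity.
For octonions, alternativity forces the coefficient ring `S` to be commutative
(`mul_comm_of_isAlternativeMul`), the complexification is the octonion algebra over the commutative
ring `S ⊕ S 𝐢`, and the multiplicative norm `n(x) = x x^*` gives the claim
(`cdMul_three_cancel`). Hence a left inverse of `x` becomes a right inverse of the operator of
right multiplication by `x`, and a right inverse of the operator, evaluated at the unit, gives back
a left inverse of `x`. The norm of `Complexified R` is not complex homogeneous, so the operators act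
on the space `ComplexMaps R` of real linear maps `ℂ → R`, which carries an equivalent norm that is.

*Patching.* Both families of functions are Banach algebras under the pointwise product
(`WienerClass`). A function in such an algebra that is close, in the norm of the algebra and after
multiplication by a cutoff, to its value at a point is inverted near this point by a Neumann series
(`WienerClass.exists_mul_eq_cutoff`). If `y` is a right inverse of `x` on `A` and `x w = φ` for a
cutoff `φ`, then `w + (1 - φ) y` is a right inverse of `x` on `A` and wherever `φ = 1`
(`WienerClass.RightInvOn.union`). Finitely many steps cover the whole space.

*Series.* The tail of the series is small by comparison with the bound on the inverses. The
finitely many remaining characters are made almost constant by cutoffs on the circle of bounded `ℓ¹`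
norm whose product with `e^{iθ} - 1` is small in `ℓ¹` (`exists_circle_cutoff`). The cells on which
these characters are close to given values form a finite cover by compactness of a torus
(`exists_finite_cover_wave`), which is where the uniform bound on the inverses is used: the cells
have one size.

*Integrals.* By continuity of translation in `L¹`, a Fourier transform is almost constant on narrow
cutoffs and almost zero off wide ones (`integralClass_comp_smul_sub_mul`). The second fact gives an
inverse outside a ball, because the constant term is not zero, and the first gives inverses near the
points of the ball.

*Real coefficients.* If the coefficients of `x` are real, `x(-t)` is the conjugate of `x(t)`, so the
mean of `y(t)` and the conjugate of `y(-t)` is again a left inverse. Its coefficients are the real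
parts of those of `y`.
-/

/-! ### Banach algebras of functions, and patching of local inverses -/

/-- A Banach algebra of functions `X → T` under the pointwise product. `NormLE f C` says that `f`
belongs to the algebra and has norm at most `C` there; completeness is the closure under absolutely
convergent series. The algebra need not contain the constants. -/
structure WienerClass (X T : Type*) [NormedRing T] [NormedAlgebra ℂ T] where
  /-- `f` belongs to the class, with norm at most `C`. -/
  NormLE : (X → T) → ℝ → Prop
  zero : NormLE (fun _ => 0) 0
  norm_apply_le : ∀ {f C}, NormLE f C → ∀ t, ‖f t‖ ≤ C
  smul : ∀ {f C} (c : ℂ), NormLE f C → NormLE (fun t => c • f t) (‖c‖ * C)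
  mul : ∀ {f g C D}, NormLE f C → NormLE g D → NormLE (fun t => f t * g t) (C * D)
  mul_const : ∀ {f C} (z : T), NormLE f C → NormLE (fun t => f t * z) (C * ‖z‖)
  tsum : ∀ {f : ℕ → X → T} {C : ℕ → ℝ}, (∀ n, NormLE (f n) (C n)) → Summable C →
    NormLE (fun t => ∑' n, f n t) (∑' n, C n)

namespace WienerClass

variable {X T : Type*} [NormedRing T] [NormedAlgebra ℂ T] (W : WienerClass X T)

lemma nonneg [Nonempty X] {f : X → T} {C : ℝ} (hf : W.NormLE f C) : 0 ≤ C :=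
  (norm_nonneg _).trans (W.norm_apply_le hf (Classical.arbitrary X))

lemma sum_range {f : ℕ → X → T} {C : ℕ → ℝ} (N : ℕ) (h : ∀ n < N, W.NormLE (f n) (C n)) :
    W.NormLE (fun t => ∑ n ∈ Finset.range N, f n t) (∑ n ∈ Finset.range N, C n) := by
  have key := W.tsum (f := fun n t => if n < N then f n t else 0)
    (C := fun n => if n < N then C n else 0) (fun n => ?_)
    (summable_of_ne_finset_zero (s := Finset.range N) fun n hn => by simp at hn; simp [hn])
  · convert key using 2 with t
    · rw [tsum_eq_sum (s := Finset.range N) fun n hn => by simp at hn; simp [hn]]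
      exact Finset.sum_congr rfl fun n hn => by simp at hn; simp [hn]
    · rw [tsum_eq_sum (s := Finset.range N) fun n hn => by simp at hn; simp [hn]]
      exact Finset.sum_congr rfl fun n hn => by simp at hn; simp [hn]
  · by_cases hn : n < N
    · simpa [hn] using h n hn
    · simpa [hn] using W.zero

lemma add {f g : X → T} {C D : ℝ} (hf : W.NormLE f C) (hg : W.NormLE g D) :
    W.NormLE (fun t => f t + g t) (C + D) := by
  have := W.sum_range (f := fun n => if n = 0 then f else g)
    (C := fun n => if n = 0 then C else D) 2 (fun n _ => by split_ifs <;> assumption)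
  simpa [Finset.sum_range_succ] using this

lemma neg {f : X → T} {C : ℝ} (hf : W.NormLE f C) : W.NormLE (fun t => -f t) C := by
  simpa using W.smul (-1) hf

lemma sub {f g : X → T} {C D : ℝ} (hf : W.NormLE f C) (hg : W.NormLE g D) :
    W.NormLE (fun t => f t - g t) (C + D) := by
  simpa [sub_eq_add_neg] using W.add hf (W.neg hg)

lemma scalar_mul {φ ψ : X → ℂ} {C D : ℝ} (hφ : W.NormLE (fun t => φ t • 1) C)
    (hψ : W.NormLE (fun t => ψ t • 1) D) : W.NormLE (fun t => (φ t * ψ t) • (1 : T)) (C * D) := by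
  simpa [smul_smul, mul_comm] using W.mul hφ hψ

lemma scalar_smul {φ : X → ℂ} {f : X → T} {C D : ℝ} (hφ : W.NormLE (fun t => φ t • 1) C)
    (hf : W.NormLE f D) : W.NormLE (fun t => φ t • f t) (C * D) := by
  simpa using W.mul hφ hf

lemma scalar_smul_const {φ : X → ℂ} {C : ℝ} (hφ : W.NormLE (fun t => φ t • 1) C) (z : T) :
    W.NormLE (fun t => φ t • z) (C * ‖z‖) := by
  simpa using W.mul_const z hφ

lemma pow_succ [Nonempty X] {f : X → T} {C : ℝ} (hf : W.NormLE f C) (n : ℕ) :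
    W.NormLE (fun t => f t ^ (n + 1)) (C ^ (n + 1)) := by
  induction n with
  | zero => simpa using hf
  | succ n ih => simpa [_root_.pow_succ] using W.mul ih hf

/-- The Neumann series: an element at distance less than `1` from the unit has a right inverse. -/
lemma exists_one_add_mul_one_add [Nonempty X] [CompleteSpace T] {k : X → T} {C : ℝ}
    (hk : W.NormLE k C) (hC : C < 1) :
    ∃ (h : X → T) (D : ℝ), W.NormLE h D ∧ ∀ t, (1 + k t) * (1 + h t) = 1 := by
  have hC0 := W.nonneg hk
  have hs : Summable fun n => C ^ (n + 1) :=
    (summable_nat_add_iff 1).2 (summable_geometric_of_lt_one hC0 hC)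
  refine ⟨_, _, W.tsum (fun n => W.pow_succ (W.neg hk) n) hs, fun t => ?_⟩
  have hlt : ‖-k t‖ < 1 := by rw [norm_neg]; exact (W.norm_apply_le hk t).trans_lt hC
  have h1 := mul_neg_geom_series (-k t) hlt
  have hsum : Summable fun n => (-k t) ^ n := summable_geometric_of_norm_lt_one hlt
  rw [hsum.tsum_eq_zero_add] at h1
  simpa using h1

/-- On `A`, the function `x` has a right inverse that is the sum of a scalar and an element of the
class. -/
def RightInvOn (x : X → T) (A : Set X) : Prop :=
  ∃ (q : ℂ) (b : X → T) (D : ℝ), W.NormLE b D ∧ ∀ t ∈ A, x t * (q • 1 + b t) = 1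

variable {W}

lemma RightInvOn.mono {x : X → T} {A B : Set X} (h : W.RightInvOn x B) (hAB : A ⊆ B) :
    W.RightInvOn x A := by
  obtain ⟨q, b, D, hb, h⟩ := h
  exact ⟨q, b, D, hb, fun t ht => h t (hAB ht)⟩

/-- Patching: if `y` is a right inverse of `x` on `A`, and `x w = φ` everywhere, then
`w + (1 - φ) y` is a right inverse of `x` on `A` and wherever `φ = 1`. -/
lemma RightInvOn.union {x : X → T} {A : Set X} (h : W.RightInvOn x A) {φ : X → ℂ} {w : X → T}
    {C D : ℝ} (hφ : W.NormLE (fun t => φ t • 1) C) (hw : W.NormLE w D)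
    (hxw : ∀ t, x t * w t = φ t • 1) : W.RightInvOn x (A ∪ {t | φ t = 1}) := by
  obtain ⟨q, b, E, hb, hA⟩ := h
  refine ⟨q, _, _, W.add hw (W.sub (W.sub hb (W.smul q hφ)) (W.scalar_smul hφ hb)),
    fun t ht => ?_⟩
  have hy : q • 1 + (w t + (b t - q • φ t • 1 - φ t • b t)) =
      w t + (1 - φ t) • (q • 1 + b t) := by module
  rw [hy, mul_add, hxw, mul_smul_comm]
  rcases ht with ht | ht
  · rw [hA t ht]; module
  · rw [show φ t = 1 from ht]; simp

/-- A local right inverse: if `x z` is close to `1` in the norm of the class on the support of the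
cutoff `φ`, then `φ` is a right multiple of `x`. -/
lemma exists_mul_eq_cutoff [Nonempty X] [CompleteSpace T] {x k : X → T} {φ : X → ℂ} {C D : ℝ}
    {z : T} (hφ : W.NormLE (fun t => φ t • 1) D) (hk : W.NormLE k C) (hC : C < 1)
    (hxz : ∀ t, φ t ≠ 0 → x t * z = 1 + k t) :
    ∃ (w : X → T) (D' : ℝ), W.NormLE w D' ∧ ∀ t, x t * w t = φ t • 1 := by
  obtain ⟨h, E, hh, hkh⟩ := W.exists_one_add_mul_one_add hk hC
  have hz := W.scalar_smul_const hφ z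
  refine ⟨_, _, W.add hz (W.mul hz hh), fun t => ?_⟩
  by_cases h0 : φ t = 0
  · simp [h0]
  · have hw : φ t • z + φ t • z * h t = φ t • (z * (1 + h t)) := by
      rw [mul_add, mul_one, smul_add, smul_mul_assoc]
    rw [hw, mul_smul_comm, ← mul_assoc, hxz t h0, hkh]

end WienerClass

/-! ### Characters and absolutely convergent series of characters -/

section wave

variable {V : Type*} [NormedAddCommGroup V] [InnerProductSpace ℝ V]

/-- The character `t ↦ e^{(β, t) 𝐢}` of frequency `β`. -/
noncomputable def wave (β t : V) : ℂ := Complex.exp ((inner ℝ β t : ℝ) * Complex.I)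

lemma norm_wave (β t : V) : ‖wave β t‖ = 1 := Complex.norm_exp_ofReal_mul_I _

@[simp] lemma wave_zero_left (t : V) : wave 0 t = 1 := by simp [wave]

@[simp] lemma wave_zero_right (β : V) : wave β 0 = 1 := by simp [wave]

lemma wave_add_left (β γ t : V) : wave (β + γ) t = wave β t * wave γ t := by
  simp [wave, inner_add_left, add_mul, Complex.exp_add]

lemma wave_add_right (β s t : V) : wave β (s + t) = wave β s * wave β t := by
  simp [wave, inner_add_right, add_mul, Complex.exp_add]

lemma wave_smul_left (c : ℝ) (β t : V) : wave (c • β) t = wave β (c • t) := by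
  simp [wave, inner_smul_left, inner_smul_right]

lemma wave_neg_right (β t : V) : wave β (-t) = starRingEnd ℂ (wave β t) := by
  simp [wave, ← Complex.exp_conj]

lemma continuous_wave : Continuous fun p : V × V => wave p.1 p.2 := by
  unfold wave; fun_prop

end wave

section seriesClass

variable {V T : Type*} [NormedAddCommGroup V] [InnerProductSpace ℝ V]
  [NormedRing T] [NormedAlgebra ℂ T] [CompleteSpace T]

lemma summable_wave_smul {ι : Type*} {a : ι → T} (β : ι → V) (ha : Summable fun n => ‖a n‖)
    (t : V) : Summable fun n => wave (β n) t • a n :=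
  Summable.of_norm (by simpa [norm_smul, norm_wave] using ha)

/-- Membership of `f` in the class of absolutely convergent series `∑ e^{(β_n, t) 𝐢} a_n`, with
`∑ ‖a_n‖ ≤ C`. -/
def SeriesNormLE (f : V → T) (C : ℝ) : Prop :=
  ∃ (a : ℕ → T) (β : ℕ → V), (Summable fun n => ‖a n‖) ∧ ∑' n, ‖a n‖ ≤ C ∧
    ∀ t, f t = ∑' n, wave (β n) t • a n

omit [CompleteSpace T] in
lemma seriesNormLE_of_denumerable {ι : Type*} [Denumerable ι] {a : ι → T} (β : ι → V) {C : ℝ}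
    (ha : Summable fun n => ‖a n‖) (hC : ∑' n, ‖a n‖ ≤ C) :
    SeriesNormLE (fun t => ∑' n, wave (β n) t • a n) C := by
  let σ := (Denumerable.eqv ι).symm
  refine ⟨a ∘ σ, β ∘ σ, σ.summable_iff.2 ha, ?_, fun t => ?_⟩
  · exact (σ.tsum_eq fun n => ‖a n‖).trans_le hC
  · exact (σ.tsum_eq fun n => wave (β n) t • a n).symm

variable (V T) in
/-- Sums of absolutely convergent series of characters with coefficients in `T`. -/
noncomputable def seriesClass : WienerClass V T where
  NormLE := SeriesNormLE
  zero := ⟨0, 0, by simp [summable_zero], by simp, by simp⟩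
  norm_apply_le := by
    rintro f C ⟨a, β, ha, hC, hf⟩ t
    rw [hf]
    refine le_trans (tsum_of_norm_bounded ha.hasSum fun n => ?_) hC
    simp [norm_smul, norm_wave]
  smul := by
    rintro f C c ⟨a, β, ha, hC, hf⟩
    refine ⟨fun n => c • a n, β, ?_, ?_, fun t => ?_⟩
    · simpa [norm_smul] using ha.mul_left ‖c‖
    · simp only [norm_smul, tsum_mul_left]
      gcongr
    · simp only [hf, smul_comm _ c]
      exact ((summable_wave_smul β ha t).tsum_const_smul c).symm
  mul := by
    rintro f g C D ⟨a, β, ha, hC, hf⟩ ⟨b, γ, hb, hD, hg⟩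
    have hab := ha.mul_norm hb
    have hle : ∑' p : ℕ × ℕ, ‖a p.1 * b p.2‖ ≤ C * D := by
      have h2 : ∑' p : ℕ × ℕ, ‖a p.1 * b p.2‖ ≤ ∑' p : ℕ × ℕ, ‖a p.1‖ * ‖b p.2‖ :=
        hab.tsum_le_tsum (fun p => norm_mul_le _ _)
          (ha.mul_of_nonneg hb (fun _ => norm_nonneg _) fun _ => norm_nonneg _)
      have h0 : 0 ≤ ∑' n, ‖b n‖ := tsum_nonneg fun n => norm_nonneg _
      refine h2.trans ?_
      rw [← tsum_mul_tsum_of_summable_norm (f := fun n => ‖a n‖) (g := fun n => ‖b n‖)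
        (by simpa using ha) (by simpa using hb)]
      exact mul_le_mul hC hD h0 (le_trans (tsum_nonneg fun n => norm_nonneg _) hC)
    convert seriesNormLE_of_denumerable (fun p : ℕ × ℕ => β p.1 + γ p.2) hab hle using 2 with t
    rw [hf, hg, tsum_mul_tsum_of_summable_norm (by simpa [norm_smul, norm_wave] using ha)
      (by simpa [norm_smul, norm_wave] using hb)]
    simp only [wave_add_left, smul_mul_smul_comm]
  mul_const := by
    rintro f C z ⟨a, β, ha, hC, hf⟩
    have hs : Summable fun n => ‖a n * z‖ :=
      (ha.mul_right ‖z‖).of_nonneg_of_le (fun _ => norm_nonneg _) fun n => norm_mul_le _ _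
    refine ⟨fun n => a n * z, β, hs, ?_, fun t => ?_⟩
    · refine (hs.tsum_le_tsum (fun n => norm_mul_le _ _) (ha.mul_right _)).trans ?_
      rw [tsum_mul_right]
      gcongr
    · simp only []
      rw [hf, ← (summable_wave_smul β ha t).tsum_mul_right]
      simp
  tsum := by
    intro f C hf hC
    choose a β ha haC hf using hf
    have hs : Summable fun p : ℕ × ℕ => ‖a p.1 p.2‖ :=
      (summable_prod_of_nonneg fun _ => norm_nonneg _).2 ⟨ha, hC.of_nonneg_of_le
        (fun n => tsum_nonneg fun _ => norm_nonneg _) haC⟩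
    have hle : ∑' p : ℕ × ℕ, ‖a p.1 p.2‖ ≤ ∑' n, C n := by
      rw [hs.tsum_prod]
      exact hs.prod.tsum_le_tsum haC hC
    convert seriesNormLE_of_denumerable (fun p : ℕ × ℕ => β p.1 p.2) hs hle using 2 with t
    rw [(summable_wave_smul _ hs t).tsum_prod]
    simp only [hf]

end seriesClass

/-! ### Cutoff functions on the circle -/

section circle

open FourierTransform SchwartzMap

lemma hasSum_telescope_inv_one_add {δ : ℝ} (hδ : 0 < δ) :
    HasSum (fun k : ℕ => 2 * (1 / (1 + k * δ) - 1 / (1 + (k + 1 : ℕ) * δ))) 2 := by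
  rw [hasSum_iff_tendsto_nat_of_nonneg]
  · have h (n : ℕ) : ∑ k ∈ Finset.range n, 2 * (1 / (1 + k * δ) - 1 / (1 + (k + 1 : ℕ) * δ)) =
        2 * (1 - 1 / (1 + n * δ)) := by
      rw [← Finset.mul_sum, Finset.sum_range_sub' (fun k : ℕ => 1 / (1 + k * δ))]
      simp
    simp only [h]
    have h1 : Filter.Tendsto (fun n : ℕ => 1 + (n : ℝ) * δ) Filter.atTop Filter.atTop :=
      Filter.tendsto_atTop_add_const_left _ _
        (tendsto_natCast_atTop_atTop.atTop_mul_const hδ)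
    simpa using ((tendsto_const_nhds (x := (1 : ℝ))).sub
      (Filter.Tendsto.const_div_atTop h1 1)).const_mul 2
  · intro k
    have : 1 / (1 + (k + 1 : ℕ) * δ) ≤ 1 / (1 + k * δ) := by
      apply one_div_le_one_div_of_le (by positivity)
      push_cast; nlinarith
    linarith

lemma div_one_add_sq_le_telescope {δ : ℝ} (hδ : 0 < δ) (k : ℕ) :
    δ / (1 + (δ * (k + 1)) ^ 2) ≤ 2 * (1 / (1 + k * δ) - 1 / (1 + (k + 1 : ℕ) * δ)) := by
  have h1 : 0 < 1 + k * δ := by positivity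
  have h2 : 0 < 1 + (k + 1 : ℕ) * δ := by positivity
  rw [div_sub_div _ _ h1.ne' h2.ne', mul_div_assoc', div_le_div_iff₀ (by positivity) (by positivity)]
  have h3 : (1 + k * δ) * (1 + (k + 1 : ℕ) * δ) ≤ 2 * (1 + (δ * (k + 1)) ^ 2) := by
    push_cast
    nlinarith [sq_nonneg (1 - δ * (k + 1)), mul_pos hδ h2, mul_nonneg hδ.le (Nat.cast_nonneg k)]
  calc δ * ((1 + k * δ) * (1 + (k + 1 : ℕ) * δ)) ≤ δ * (2 * (1 + (δ * (k + 1)) ^ 2)) := by gcongr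
    _ = _ := by push_cast; ring

/-- Riemann sums of `1 / (1 + ξ²)` over `δ ℤ` are bounded uniformly in the mesh `δ ≤ 1`. -/
lemma summable_and_tsum_div_one_add_sq_le {δ : ℝ} (hδ : 0 < δ) (hδ1 : δ ≤ 1) :
    (Summable fun n : ℤ => δ / (1 + (δ * n) ^ 2)) ∧ ∑' n : ℤ, δ / (1 + (δ * n) ^ 2) ≤ 5 := by
  have hT := hasSum_telescope_inv_one_add hδ
  have hle (k : ℕ) := div_one_add_sq_le_telescope hδ k
  have hs : Summable fun k : ℕ => δ / (1 + (δ * (k + 1)) ^ 2) :=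
    hT.summable.of_nonneg_of_le (fun k => by positivity) hle
  have hsum : ∑' k : ℕ, δ / (1 + (δ * (k + 1)) ^ 2) ≤ 2 :=
    (hs.tsum_le_tsum hle hT.summable).trans hT.tsum_eq.le
  obtain ⟨u, hu⟩ : ∃ u : ℤ → ℝ, u = fun n : ℤ => δ / (1 + (δ * n) ^ 2) := ⟨_, rfl⟩
  have hu1 (k : ℕ) : u ((k + 1 : ℕ) : ℤ) = δ / (1 + (δ * (k + 1)) ^ 2) := by simp [hu]
  have hu2 (k : ℕ) : u (-(k + 1)) = δ / (1 + (δ * (k + 1)) ^ 2) := by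
    rw [hu, ← neg_sq (δ * _)]; push_cast; ring_nf
  have hpos : Summable fun k : ℕ => u k := (summable_nat_add_iff 1).1 (by simpa only [hu1] using hs)
  have hneg : Summable fun k : ℕ => u (-(k + 1)) := by simpa only [hu2] using hs
  have h0 : u (0 : ℕ) ≤ 1 := by simpa [hu] using hδ1
  rw [← hu]
  refine ⟨Summable.of_nat_of_neg_add_one hpos hneg, ?_⟩
  rw [tsum_of_nat_of_neg_add_one hpos hneg, hpos.tsum_eq_zero_add]
  simp only [hu1, hu2]
  exact (add_le_add (add_le_add h0 hsum) hsum).trans (by norm_num)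

lemma SchwartzMap.exists_norm_le_div_one_add_sq {F : Type*} [NormedAddCommGroup F] [NormedSpace ℝ F]
    (G : 𝓢(ℝ, F)) : ∃ A, 0 < A ∧ ∀ ξ, ‖G ξ‖ ≤ A / (1 + ξ ^ 2) := by
  obtain ⟨A, hA, h⟩ := G.decay 0 0
  obtain ⟨B, hB, h'⟩ := G.decay 2 0
  refine ⟨A + B, by positivity, fun ξ => ?_⟩
  rw [le_div_iff₀ (by positivity)]
  have := h ξ; have := h' ξ
  simp only [norm_iteratedFDeriv_zero, pow_zero, one_mul, Real.norm_eq_abs, sq_abs] at *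
  linarith

lemma SchwartzMap.exists_norm_sub_le_div_one_add_sq {F : Type*} [NormedAddCommGroup F]
    [NormedSpace ℝ F] (G : 𝓢(ℝ, F)) :
    ∃ A, 0 < A ∧ ∀ ξ δ, 0 < δ → δ ≤ 1 → ‖G (ξ - δ) - G ξ‖ ≤ A * δ / (1 + ξ ^ 2) := by
  obtain ⟨A, hA, h⟩ := (derivCLM ℝ F G).exists_norm_le_div_one_add_sq
  refine ⟨3 * A, by positivity, fun ξ δ hδ hδ1 => ?_⟩
  have key := Convex.norm_image_sub_le_of_norm_deriv_le (f := G) (s := Set.Icc (ξ - δ) ξ)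
    (x := ξ) (y := ξ - δ) (C := 3 * A / (1 + ξ ^ 2)) (fun x _ => G.differentiableAt)
    (fun x hx => ?_) (convex_Icc _ _) ⟨by linarith, le_rfl⟩ ⟨le_rfl, by linarith⟩
  · refine key.trans_eq ?_
    rw [sub_sub_cancel_left, norm_neg, Real.norm_of_nonneg hδ.le]
    ring
  · have := h x
    rw [derivCLM_apply] at this
    refine this.trans ?_
    rw [div_le_div_iff₀ (by positivity) (by positivity)]
    have : 1 + ξ ^ 2 ≤ 3 * (1 + x ^ 2) := by
      nlinarith [hx.1, hx.2, sq_nonneg (2 * x - ξ), sq_nonneg (ξ - x)]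
    nlinarith

/-- Poisson summation for a smooth function supported in `(-1/2, 1/2)`: its Fourier transform at the
integers gives the Fourier coefficients of its `1`-periodic extension. -/
lemma tsum_fourier_mul_exp_eq {g : ℝ → ℂ} (hc : HasCompactSupport g)
    (hg : ContDiff ℝ (⊤ : ℕ∞) g) (hsupp : ∀ x, 1 / 2 ≤ |x| → g x = 0) (θ : ℝ) :
    ∑' n : ℤ, 𝓕 g n * Complex.exp ((n * θ : ℝ) * Complex.I) =
      g (θ / (2 * Real.pi) - round (θ / (2 * Real.pi))) := by
  set x := θ / (2 * Real.pi) with hx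
  have h := (hc.toSchwartzMap hg).tsum_eq_tsum_fourier x
  have hθ : θ = 2 * Real.pi * x := by rw [hx]; field_simp
  have hR : ∑' n : ℤ, 𝓕 g n * Complex.exp ((n * θ : ℝ) * Complex.I) =
      ∑' n : ℤ, 𝓕 (hc.toSchwartzMap hg) n * fourier n (x : UnitAddCircle) := by
    refine tsum_congr fun n => ?_
    rw [SchwartzMap.fourier_coe, fourier_coe_apply, hθ]
    congr 2
    push_cast; ring
  rw [hR, ← h, tsum_eq_single (-round x)]
  · change g _ = _
    push_cast
    rw [sub_eq_add_neg]
  · intro n hn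
    apply hsupp
    have h1 := abs_sub_round x
    have h2 : (1 : ℝ) ≤ |((n + round x : ℤ) : ℝ)| := by
      rw [← Int.cast_abs]
      exact_mod_cast Int.one_le_abs (by lia)
    have h3 : ((n + round x : ℤ) : ℝ) = (x + n) - (x - round x) := by push_cast; ring
    rw [h3] at h2
    have := abs_sub (x + n) (x - round x)
    linarith

lemma fourier_comp_div (g : ℝ → ℂ) {δ : ℝ} (hδ : 0 < δ) (ξ : ℝ) :
    𝓕 (fun x => g (x / δ)) ξ = δ * 𝓕 g (δ * ξ) := by
  simp only [Real.fourier_eq']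
  have := Measure.integral_comp_div
    (fun x => Complex.exp (↑(-2 * Real.pi * inner ℝ x (δ * ξ)) * Complex.I) • g x) δ
  rw [abs_of_pos hδ, Complex.real_smul] at this
  rw [← this]
  congr 1 with x
  congr 5
  simp only [RCLike.inner_apply, conj_trivial]
  field_simp

lemma four_mul_abs_le_norm_exp_sub_one {y : ℝ} (hy : |y| ≤ 1 / 2) :
    4 * |y| ≤ ‖Complex.exp ((2 * Real.pi * y : ℝ) * Complex.I) - 1‖ := by
  rw [mul_comm _ Complex.I, Complex.norm_exp_I_mul_ofReal_sub_one, norm_mul, Real.norm_two,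
    show 2 * Real.pi * y / 2 = Real.pi * y by ring, Real.norm_eq_abs]
  have h := Real.mul_le_sin (x := Real.pi * |y|) (by positivity)
    (by nlinarith [Real.pi_pos])
  have h2 : |Real.sin (Real.pi * y)| = |Real.sin (Real.pi * |y|)| := by
    rcases abs_cases y with ⟨h, _⟩ | ⟨h, _⟩ <;> rw [h]
    rw [mul_neg, Real.sin_neg, abs_neg]
  rw [h2]
  have h3 : 2 / Real.pi * (Real.pi * |y|) = 2 * |y| := by field_simp
  linarith [le_abs_self (Real.sin (Real.pi * |y|))]

/-- Cutoff functions on the circle. There are functions `∑ c_n e^{inθ}` equal to `1` near `θ = 0`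
whose `ℓ¹` norm stays bounded, while their product with `e^{iθ} - 1` has arbitrarily small `ℓ¹`
norm; `∑ c'_n e^{inθ}` is a second cutoff, supported where the first one equals `1`. -/
lemma exists_circle_cutoff : ∃ M : ℝ, ∀ ε > 0, ∃ (c c' : ℤ → ℂ) (ρ : ℝ), 0 < ρ ∧
    (Summable fun n => ‖c n‖) ∧ ∑' n, ‖c n‖ ≤ M ∧ (Summable fun n => ‖c' n‖) ∧
    (Summable fun n => ‖c (n - 1) - c n‖) ∧ ∑' n, ‖c (n - 1) - c n‖ ≤ ε ∧
    (∀ θ : ℝ, ∑' n : ℤ, c' n * Complex.exp ((n * θ : ℝ) * Complex.I) ≠ 0 →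
      ∑' n : ℤ, c n * Complex.exp ((n * θ : ℝ) * Complex.I) = 1) ∧
    ∀ θ : ℝ, ‖Complex.exp (θ * Complex.I) - 1‖ < ρ →
      ∑' n : ℤ, c' n * Complex.exp ((n * θ : ℝ) * Complex.I) = 1 := by
  -- the cutoffs are the `1`-periodic extensions of `f(x / δ)` and `f'(x / δ)` at `x = θ / 2π`; by
  -- Poisson summation the coefficients are samples of a Fourier transform on the mesh `δ ℤ`
  let f : ContDiffBump (0 : ℝ) := ⟨2, 3, by norm_num, by norm_num⟩
  let f' : ContDiffBump (0 : ℝ) := ⟨1, 2, by norm_num, by norm_num⟩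
  let g (f : ContDiffBump (0 : ℝ)) : ℝ → ℂ := fun x => (f x : ℂ)
  have hgc (f : ContDiffBump (0 : ℝ)) : HasCompactSupport (g f) :=
    f.hasCompactSupport.comp_left (g := fun x : ℝ => (x : ℂ)) rfl
  have hgs (f : ContDiffBump (0 : ℝ)) : ContDiff ℝ (⊤ : ℕ∞) (g f) :=
    Complex.ofRealCLM.contDiff.comp f.contDiff
  let G (f : ContDiffBump (0 : ℝ)) : 𝓢(ℝ, ℂ) := 𝓕 ((hgc f).toSchwartzMap (hgs f))
  have hG (f : ContDiffBump (0 : ℝ)) (ξ : ℝ) : 𝓕 (g f) ξ = G f ξ := by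
    simp only [G, SchwartzMap.fourier_coe]; rfl
  obtain ⟨A, hA, hA'⟩ := (G f).exists_norm_le_div_one_add_sq
  obtain ⟨A₁, hA₁, hA₁'⟩ := (G f').exists_norm_le_div_one_add_sq
  obtain ⟨B, hB, hB'⟩ := (G f).exists_norm_sub_le_div_one_add_sq
  refine ⟨A * 5, fun ε hε => ?_⟩
  obtain ⟨δ, hδ, hδ8, hδε⟩ : ∃ δ : ℝ, 0 < δ ∧ δ ≤ 1 / 8 ∧ B * δ * 5 ≤ ε := by
    refine ⟨min (1 / 8) (ε / (B * 5)), by positivity, min_le_left _ _, ?_⟩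
    have := min_le_right (1 / 8) (ε / (B * 5))
    rw [le_div_iff₀ (by positivity)] at this
    linarith
  obtain ⟨hS, hS5⟩ := summable_and_tsum_div_one_add_sq_le hδ (by linarith)
  have hper (f : ContDiffBump (0 : ℝ)) (hf : f.rOut ≤ 3) (θ : ℝ) :
      ∑' n : ℤ, (δ * G f (δ * n)) * Complex.exp ((n * θ : ℝ) * Complex.I) =
        g f ((θ / (2 * Real.pi) - round (θ / (2 * Real.pi))) / δ) := by
    rw [← tsum_fourier_mul_exp_eq (g := fun x => g f (x / δ))]
    · exact tsum_congr fun n => by rw [fourier_comp_div _ hδ, hG]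
    · have := (hgc f).comp_homeomorph (Homeomorph.mulRight₀ δ⁻¹ (inv_ne_zero hδ.ne'))
      simpa [Function.comp_def, div_eq_mul_inv] using this
    · exact (hgs f).comp (contDiff_id.div_const δ)
    · intro x hx
      simp only [g, Complex.ofReal_eq_zero]
      apply f.zero_of_le_dist
      rw [dist_zero_right, Real.norm_eq_abs, abs_div, abs_of_pos hδ, le_div_iff₀ hδ]
      nlinarith
  have hbd {A : ℝ} {u : ℤ → ℝ} (hu0 : ∀ n, 0 ≤ u n)
      (hu : ∀ n : ℤ, u n ≤ A * (δ / (1 + (δ * n) ^ 2))) (hA : 0 < A) :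
      Summable u ∧ ∑' n, u n ≤ A * 5 := by
    have h1 := (hS.mul_left A).of_nonneg_of_le hu0 hu
    refine ⟨h1, (h1.tsum_le_tsum hu (hS.mul_left A)).trans ?_⟩
    rw [tsum_mul_left]
    gcongr
  have h1 := hbd (u := fun n : ℤ => ‖δ * G f (δ * n)‖) (fun _ => norm_nonneg _) (fun n => by
    rw [norm_mul, Complex.norm_real, Real.norm_of_nonneg hδ.le]
    calc δ * ‖G f (δ * n)‖ ≤ δ * (A / (1 + (δ * n) ^ 2)) := by gcongr; exact hA' _
      _ = _ := by ring) hA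
  have h2 := hbd (u := fun n : ℤ => ‖δ * G f' (δ * n)‖) (fun _ => norm_nonneg _) (fun n => by
    rw [norm_mul, Complex.norm_real, Real.norm_of_nonneg hδ.le]
    calc δ * ‖G f' (δ * n)‖ ≤ δ * (A₁ / (1 + (δ * n) ^ 2)) := by gcongr; exact hA₁' _
      _ = _ := by ring) hA₁
  have h3 := hbd (A := B * δ)
    (u := fun n : ℤ => ‖δ * G f (δ * (n - 1 : ℤ)) - δ * G f (δ * n)‖)
    (fun _ => norm_nonneg _) (fun n => by
      rw [← mul_sub, norm_mul, Complex.norm_real, Real.norm_of_nonneg hδ.le]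
      have := hB' (δ * n) δ hδ (by linarith)
      rw [show δ * n - δ = δ * (n - 1 : ℤ) by push_cast; ring] at this
      calc _ ≤ δ * (B * δ / (1 + (δ * n) ^ 2)) := by gcongr
        _ = _ := by ring) (by positivity)
  refine ⟨fun n => δ * G f (δ * n), fun n => δ * G f' (δ * n), 4 * δ, by positivity, h1.1, h1.2,
    h2.1, h3.1, h3.2.trans hδε, fun θ hθ => ?_, fun θ hθ => ?_⟩
  · rw [hper f' (by norm_num [f'])] at hθ
    rw [hper f le_rfl]
    simp only [g, Complex.ofReal_eq_one, ne_eq, Complex.ofReal_eq_zero] at hθ ⊢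
    apply f.one_of_mem_closedBall
    by_contra hcon
    apply hθ
    apply f'.zero_of_le_dist
    rw [Metric.mem_closedBall, not_le] at hcon
    exact hcon.le
  · rw [hper f' (by norm_num [f'])]
    simp only [g, Complex.ofReal_eq_one]
    apply f'.one_of_mem_closedBall
    set x := θ / (2 * Real.pi) with hx
    have h4 := four_mul_abs_le_norm_exp_sub_one (abs_sub_round x)
    have h5 : Complex.exp ((2 * Real.pi * (x - round x) : ℝ) * Complex.I) =
        Complex.exp (θ * Complex.I) := by
      rw [Complex.exp_eq_exp_iff_exists_int]
      refine ⟨-round x, ?_⟩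
      have hθ : θ = 2 * Real.pi * x := by rw [hx]; field_simp
      rw [hθ]
      push_cast; ring
    rw [h5] at h4
    rw [Metric.mem_closedBall, dist_zero_right, Real.norm_eq_abs, abs_div, abs_of_pos hδ,
      div_le_iff₀ hδ]
    change _ ≤ 1 * δ
    linarith

end circle

/-! ### The one-sided Wiener lemma for series of characters -/

section seriesTheorem

variable {V T : Type*} [NormedAddCommGroup V] [InnerProductSpace ℝ V]
  [NormedRing T] [NormedAlgebra ℂ T] [CompleteSpace T]

lemma seriesClass_const (z : T) : (seriesClass V T).NormLE (fun _ => z) ‖z‖ := by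
  refine ⟨fun n => if n = 0 then z else 0, fun _ => 0,
    summable_of_ne_finset_zero (s := {0}) fun n hn => by simp at hn; simp [hn], ?_, fun t => ?_⟩
  · rw [tsum_eq_single 0 fun n hn => by simp [hn]]; simp
  · rw [tsum_eq_single 0 fun n hn => by simp [hn]]; simp

lemma seriesClass_prod (s : Finset ℕ) {φ : ℕ → V → ℂ} {D : ℝ}
    (hφ : ∀ n ∈ s, (seriesClass V T).NormLE (fun t => φ n t • 1) D) :
    (seriesClass V T).NormLE (fun t => (∏ n ∈ s, φ n t) • 1) (‖(1 : T)‖ * D ^ s.card) := by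
  classical
  induction s using Finset.induction_on with
  | empty => simpa using seriesClass_const (V := V) (1 : T)
  | insert n s hn ih =>
    have h := (seriesClass V T).scalar_mul (hφ n (by simp))
      (ih fun m hm => hφ m (Finset.mem_insert_of_mem hm))
    simp only [Finset.prod_insert hn, Finset.card_insert_of_notMem hn, pow_succ]
    convert h using 1
    ring

/-- A periodic function `∑ c_n e^{inθ}` evaluated at the angle `(g, t - t₀)`. -/
noncomputable def circleAt (c : ℤ → ℂ) (g t₀ t : V) : ℂ :=
  ∑' n : ℤ, c n * Complex.exp ((n * inner ℝ g (t - t₀) : ℝ) * Complex.I)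

lemma seriesClass_circleAt {c : ℤ → ℂ} (hc : Summable fun n => ‖c n‖) (g t₀ : V) :
    (seriesClass V T).NormLE (fun t => circleAt c g t₀ t • 1) ((∑' n, ‖c n‖) * ‖(1 : T)‖) := by
  have hn (n : ℤ) : ‖(c n * wave ((n : ℝ) • g) (-t₀)) • (1 : T)‖ = ‖c n‖ * ‖(1 : T)‖ := by
    rw [norm_smul, norm_mul, norm_wave, mul_one]
  have ha : Summable fun n : ℤ => ‖(c n * wave ((n : ℝ) • g) (-t₀)) • (1 : T)‖ := by
    simpa only [hn] using hc.mul_right _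
  have hexp (n : ℤ) (t : V) : c n * Complex.exp ((n * inner ℝ g (t - t₀) : ℝ) * Complex.I) =
      wave ((n : ℝ) • g) t * (c n * wave ((n : ℝ) • g) (-t₀)) := by
    have : Complex.exp ((n * inner ℝ g (t - t₀) : ℝ) * Complex.I) =
        wave ((n : ℝ) • g) (t - t₀) := by
      rw [wave, real_inner_smul_left]
    rw [this, sub_eq_add_neg, wave_add_right]
    ring
  have hsum (t : V) : circleAt c g t₀ t • (1 : T) =
      ∑' n : ℤ, wave ((n : ℝ) • g) t • (c n * wave ((n : ℝ) • g) (-t₀)) • (1 : T) := by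
    have hs : Summable fun n : ℤ => wave ((n : ℝ) • g) t * (c n * wave ((n : ℝ) • g) (-t₀)) :=
      Summable.of_norm (by simpa [norm_wave] using hc)
    simp only [circleAt, hexp, smul_smul]
    exact (hs.tsum_smul_const _).symm
  simp only [hsum]
  exact seriesNormLE_of_denumerable (fun n : ℤ => (n : ℝ) • g) ha
    (by simp only [hn, tsum_mul_right]; rfl)

lemma summable_mul_exp {c : ℤ → ℂ} (hc : Summable fun n => ‖c n‖) (θ : ℝ) :
    Summable fun n : ℤ => c n * Complex.exp ((n * θ : ℝ) * Complex.I) :=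
  Summable.of_norm (by simpa only [norm_mul, Complex.norm_exp_ofReal_mul_I, mul_one] using hc)

/-- Multiplying a function on the circle by `e^{iθ} - 1` replaces its Fourier coefficients by their
differences. -/
lemma circleAt_sub {c : ℤ → ℂ} (hc : Summable fun n => ‖c n‖) (g t₀ t : V) :
    circleAt (fun n => c (n - 1) - c n) g t₀ t =
      (wave g (t - t₀) - 1) * circleAt c g t₀ t := by
  have hc' : Summable fun n => ‖c (n - 1)‖ := (Equiv.subRight (1 : ℤ)).summable_iff.2 hc
  unfold circleAt
  set θ : ℝ := inner ℝ g (t - t₀) with hθ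
  simp only [sub_mul]
  rw [(summable_mul_exp hc' θ).tsum_sub (summable_mul_exp hc θ), one_mul, ← tsum_mul_left,
    ← (Equiv.subRight (1 : ℤ)).tsum_eq fun n : ℤ =>
      wave g (t - t₀) * (c n * Complex.exp ((n * θ : ℝ) * Complex.I))]
  congr 1
  refine tsum_congr fun n => ?_
  rw [mul_left_comm, wave, ← hθ, ← Complex.exp_add, Equiv.subRight_apply]
  congr 2
  push_cast; ring

lemma norm_wave_sub_sub_one (g t₀ t : V) : ‖wave g (t - t₀) - 1‖ = ‖wave g t - wave g t₀‖ := by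
  have h : wave g t - wave g t₀ = wave g t₀ * (wave g (t - t₀) - 1) := by
    rw [mul_sub, mul_one, ← wave_add_right, add_sub_cancel]
  rw [h, norm_mul, norm_wave, one_mul]

/-- Finitely many cells, on each of which the characters of the given frequencies are almost
constant, cover the space. -/
lemma exists_finite_cover_wave (β : ℕ → V) (N : ℕ) {ρ : ℝ} (hρ : 0 < ρ) :
    ∃ U : Set V, U.Finite ∧ ∀ t, ∃ t₀ ∈ U, ∀ n < N, ‖wave (β n) t - wave (β n) t₀‖ < ρ := by
  let F : V → Fin N → ℂ := fun t n => wave (β n) t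
  have hb : TotallyBounded (Set.range F) := by
    refine TotallyBounded.subset ?_ (isCompact_closedBall (0 : Fin N → ℂ) 1).totallyBounded
    rintro _ ⟨t, rfl⟩
    rw [mem_closedBall_zero_iff]
    exact (pi_norm_le_iff_of_nonneg zero_le_one).2 fun n => (norm_wave _ _).le
  obtain ⟨s, hs, hsf, hcov⟩ := hb.exists_subset (Metric.dist_mem_uniformity hρ)
  choose! G hG using fun y (hy : y ∈ s) => hs hy
  refine ⟨G '' s, hsf.image G, fun t => ?_⟩
  obtain ⟨y, hy, hty⟩ := Set.mem_iUnion₂.1 (hcov ⟨t, rfl⟩)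
  refine ⟨G y, ⟨y, hy, rfl⟩, fun n hn => ?_⟩
  have h1 : dist (F t) (F (G y)) < ρ := by rw [hG y hy]; exact hty
  rw [← dist_eq_norm]
  exact (dist_le_pi_dist (F t) (F (G y)) ⟨n, hn⟩).trans_lt h1

lemma seriesClass_mono {f : V → T} {C C' : ℝ} (h : (seriesClass V T).NormLE f C) (hC : C ≤ C') :
    (seriesClass V T).NormLE f C' := by
  obtain ⟨a, β, h1, h2, h3⟩ := h
  exact ⟨a, β, h1, h2.trans hC, h3⟩

/-- A finite sum of characters is almost constant, in the norm of absolutely convergent series,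
after multiplication by a product of cutoffs, one for each frequency. -/
lemma seriesClass_sum_sub_mul_cutoff {c : ℤ → ℂ} (hc : Summable fun n => ‖c n‖)
    (hd : Summable fun n => ‖c (n - 1) - c n‖) {D ε : ℝ} (hD : 1 ≤ D)
    (hcD : (∑' n, ‖c n‖) * ‖(1 : T)‖ ≤ D) (hε : ∑' n, ‖c (n - 1) - c n‖ ≤ ε)
    (a : ℕ → T) (β : ℕ → V) (N : ℕ) (t₀ : V) :
    (seriesClass V T).NormLE (fun t => ∑ n ∈ Finset.range N,
        ((wave (β n) t - wave (β n) t₀) *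
          ∏ m ∈ Finset.range N, circleAt c (β m) t₀ t) • a n)
      (ε * (‖(1 : T)‖ ^ 2 * D ^ N * ∑ n ∈ Finset.range N, ‖a n‖)) := by
  classical
  have hε0 : 0 ≤ ε := (tsum_nonneg fun n => norm_nonneg _).trans hε
  have hprod (s : Finset ℕ) := seriesClass_prod (T := T) s fun m _ =>
    seriesClass_mono (seriesClass_circleAt hc (β m) t₀) hcD
  refine seriesClass_mono ((seriesClass V T).sum_range
    (C := fun n => (ε * ‖(1 : T)‖) * (‖(1 : T)‖ * D ^ N) * ‖a n‖) N fun n hn => ?_) ?_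
  · have h1 := (seriesClass V T).scalar_smul_const ((seriesClass V T).scalar_mul
      (seriesClass_circleAt hd (β n) t₀) (hprod ((Finset.range N).erase n)))
      (wave (β n) t₀ • a n)
    have hcard : ((Finset.range N).erase n).card ≤ N :=
      (Finset.card_le_card (Finset.erase_subset _ _)).trans (Finset.card_range N).le
    refine seriesClass_mono (C := (∑' n, ‖c (n - 1) - c n‖) * ‖(1 : T)‖ *
      (‖(1 : T)‖ * D ^ ((Finset.range N).erase n).card) * ‖wave (β n) t₀ • a n‖) ?_ ?_
    · convert h1 using 2 with t
      rw [circleAt_sub hc, smul_smul, ← Finset.mul_prod_erase _ _ (Finset.mem_range.2 hn)]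
      congr 1
      have h : wave (β n) t = wave (β n) t₀ * wave (β n) (t - t₀) := by
        rw [← wave_add_right, add_sub_cancel]
      rw [h]
      ring
    · rw [norm_smul, norm_wave, one_mul]
      gcongr
  · rw [← Finset.mul_sum]
    exact le_of_eq (by ring)

/-- Wiener's lemma for absolutely convergent series of characters with coefficients in a Banach
algebra, in the one-sided form of Bochner and Phillips. -/
theorem exists_series_rightInverse {a : ℕ → T} {β : ℕ → V} (ha : Summable fun n => ‖a n‖)
    {z : V → T} (hz : ∀ t, (∑' n, wave (β n) t • a n) * z t = 1) {C : ℝ} (hC : ∀ t, ‖z t‖ ≤ C) :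
    ∃ (b : ℕ → T) (τ : ℕ → V), (Summable fun n => ‖b n‖) ∧
      ∀ t, (∑' n, wave (β n) t • a n) * (∑' n, wave (τ n) t • b n) = 1 := by
  set x : V → T := fun t => ∑' n, wave (β n) t • a n with hx
  have hC0 : 0 ≤ C := (norm_nonneg _).trans (hC 0)
  obtain ⟨M, hM⟩ := exists_circle_cutoff
  -- the tail beyond `N` is small compared with the bound on the inverses
  obtain ⟨N, hN⟩ : ∃ N, ∑' n, ‖a (n + N)‖ * (8 * (C + 1)) < 1 := by
    have h := (tendsto_sum_nat_add fun n => ‖a n‖ * (8 * (C + 1))).eventually_lt_const one_pos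
    exact h.exists
  rw [tsum_mul_right] at hN
  set tail : V → T := fun t => ∑' n, wave (β (n + N)) t • a (n + N) with htail
  have haN : Summable fun n => ‖a (n + N)‖ := (summable_nat_add_iff N).2 ha
  set δ := ∑' n, ‖a (n + N)‖ with hδ
  have hδ0 : 0 ≤ δ := tsum_nonneg fun n => norm_nonneg _
  have htailN : (seriesClass V T).NormLE tail δ := ⟨_, _, haN, le_rfl, fun t => rfl⟩
  have hxt (t : V) : x t = ∑ n ∈ Finset.range N, wave (β n) t • a n + tail t :=
    ((summable_wave_smul β ha t).sum_add_tsum_nat_add N).symm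
  set D := max (M * ‖(1 : T)‖) 1 with hD
  set B := ‖(1 : T)‖ ^ 2 * D ^ N * ∑ n ∈ Finset.range N, ‖a n‖ with hB
  have hB0 : 0 ≤ B := by positivity
  obtain ⟨c, c', ρ, hρ, hc, hcM, hc', hd, hdε, hcut, hone⟩ :=
    hM (1 / (4 * (B + 1) * (C + 1))) (by positivity)
  have hcD : (∑' n, ‖c n‖) * ‖(1 : T)‖ ≤ D :=
    (mul_le_mul_of_nonneg_right hcM (norm_nonneg _)).trans (le_max_left _ _)
  -- local right inverses, with cells of a size independent of the centre
  have hlocal (t₀ : V) (A : Set V) (hA : (seriesClass V T).RightInvOn x A) :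
      (seriesClass V T).RightInvOn x
        (A ∪ {t | ∀ n < N, ‖wave (β n) t - wave (β n) t₀‖ < ρ}) := by
    set φ : V → ℂ := fun t => ∏ m ∈ Finset.range N, circleAt c' (β m) t₀ t with hφ
    have hφN := seriesClass_prod (T := T) (Finset.range N) fun m _ =>
      seriesClass_circleAt hc' (β m) t₀
    have hk := (seriesClass V T).mul_const (z t₀) ((seriesClass V T).add
      (seriesClass_sum_sub_mul_cutoff hc hd (le_max_right _ _) hcD hdε a β N t₀)
      ((seriesClass V T).sub htailN (seriesClass_const (tail t₀))))
    have hsmall : (1 / (4 * (B + 1) * (C + 1)) * B + (δ + ‖tail t₀‖)) * ‖z t₀‖ < 1 := by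
      have h1 : ‖tail t₀‖ ≤ δ := (seriesClass V T).norm_apply_le htailN t₀
      have h2 : 1 / (4 * (B + 1) * (C + 1)) * B * (C + 1) ≤ 1 / 4 := by
        have : 1 / (4 * (B + 1) * (C + 1)) * B * (C + 1) = 1 / 4 * (B / (B + 1)) := by
          field_simp
        rw [this]
        have : B / (B + 1) ≤ 1 := (div_le_one (by positivity)).2 (by linarith)
        linarith
      calc _ ≤ (1 / (4 * (B + 1) * (C + 1)) * B + (δ + δ)) * (C + 1) := by
            gcongr; linarith [hC t₀]
        _ < 1 := by nlinarith
    have hcell (t : V) (ht : φ t ≠ 0) : x t * z t₀ = 1 + (∑ n ∈ Finset.range N,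
        ((wave (β n) t - wave (β n) t₀) * ∏ m ∈ Finset.range N, circleAt c (β m) t₀ t) • a n +
          (tail t - tail t₀)) * z t₀ := by
      have h1 : ∏ m ∈ Finset.range N, circleAt c (β m) t₀ t = 1 :=
        Finset.prod_eq_one fun m hm => hcut _ (Finset.prod_ne_zero_iff.1 ht m hm)
      simp only [h1, mul_one, sub_smul, Finset.sum_sub_distrib]
      rw [← hz t₀]
      change x t * z t₀ = x t₀ * z t₀ + _
      rw [hxt, hxt, ← add_mul]
      congr 1
      abel
    obtain ⟨w, E, hw, hxw⟩ := WienerClass.exists_mul_eq_cutoff hφN hk hsmall hcell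
    refine (hA.union hφN hw hxw).mono (Set.union_subset_union_right _ fun t ht => ?_)
    refine Finset.prod_eq_one fun m hm => hone _ ?_
    have h := ht m (Finset.mem_range.1 hm)
    rw [← norm_wave_sub_sub_one] at h
    exact h
  obtain ⟨U, hU, hcov⟩ := exists_finite_cover_wave β N hρ
  have hglobal : (seriesClass V T).RightInvOn x
      {t | ∃ t₀ ∈ U, ∀ n < N, ‖wave (β n) t - wave (β n) t₀‖ < ρ} := by
    clear hcov
    induction U, hU using Set.Finite.induction_on with
    | empty => exact ⟨0, _, _, (seriesClass V T).zero, by simp⟩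
    | @insert t₁ _ _ _ ih =>
      refine (hlocal t₁ _ ih).mono ?_
      rintro t ⟨t₀, h | h, ht⟩
      · exact Or.inr (h ▸ ht)
      · exact Or.inl ⟨t₀, h, ht⟩
  obtain ⟨q, b, E, hb, hinv⟩ := hglobal
  obtain ⟨b', τ, hb', -, hτ⟩ := (seriesClass V T).add (seriesClass_const (q • 1)) hb
  exact ⟨b', τ, hb', fun t => by rw [← hτ]; exact hinv t (hcov t)⟩

end seriesTheorem

/-! ### Fourier transforms of integrable functions -/

section integralClass

open scoped Convolution

variable {V T : Type*} [NormedAddCommGroup V] [InnerProductSpace ℝ V] [FiniteDimensional ℝ V]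
  [MeasurableSpace V] [BorelSpace V] [NormedRing T] [NormedAlgebra ℂ T]

lemma integrable_wave_smul {F : Type*} [NormedAddCommGroup F] [NormedSpace ℂ F] {a : V → F}
    (ha : Integrable a) (t : V) : Integrable fun β => wave β t • a β := by
  have hc : Continuous fun β : V => wave β t :=
    continuous_wave.comp (continuous_id.prodMk continuous_const)
  refine ha.norm.mono' (hc.aestronglyMeasurable.smul ha.aestronglyMeasurable) ?_
  filter_upwards with β
  rw [norm_smul, norm_wave, one_mul]

/-- Membership of `f` in the class of Fourier transforms of integrable functions, of norm at most
`C`. -/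
def IntegralNormLE (f : V → T) (C : ℝ) : Prop :=
  ∃ a : V → T, Integrable a ∧ ∫ β, ‖a β‖ ≤ C ∧ ∀ t, f t = ∫ β, wave β t • a β

lemma integrable_tsum_of_summable_integral_norm {α F : Type*} [MeasurableSpace α] {μ : Measure α}
    [NormedAddCommGroup F] [CompleteSpace F] {a : ℕ → α → F} (ha : ∀ n, Integrable (a n) μ)
    (hs : Summable fun n => ∫ x, ‖a n x‖ ∂μ) :
    Integrable (fun x => ∑' n, a n x) μ ∧ ∫ x, ‖∑' n, a n x‖ ∂μ ≤ ∑' n, ∫ x, ‖a n x‖ ∂μ := by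
  have hn (n : ℕ) : ‖(ha n).toL1 (a n)‖ = ∫ x, ‖a n x‖ ∂μ := by
    rw [L1.norm_eq_integral_norm]
    exact integral_congr_ae ((ha n).coeFn_toL1.fun_comp norm)
  have hsn : Summable fun n => ‖(ha n).toL1 (a n)‖ := by simpa only [hn] using hs
  have hsum : ∀ᵐ x ∂μ, (∑' n, (ha n).toL1 (a n) : Lp F 1 μ) x = ∑' n, a n x := by
    filter_upwards [Lp.hasSum_coeFn_tsum (tsum_enorm_ne_top_iff_summable_norm.2 hsn),
      ae_all_iff.2 fun n => (ha n).coeFn_toL1] with x hx hx'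
    rw [← hx.tsum_eq]
    exact tsum_congr hx'
  refine ⟨(L1.integrable_coeFn _).congr hsum, ?_⟩
  rw [← integral_congr_ae (hsum.mono fun x hx => congrArg norm hx), ← L1.norm_eq_integral_norm]
  simpa only [hn] using norm_tsum_le_tsum_norm hsn

lemma wave_smul_convolution (a b : V → T) (β t : V) :
    wave β t • (a ⋆[ContinuousLinearMap.mul ℝ T] b) β =
      ((fun β => wave β t • a β) ⋆[ContinuousLinearMap.mul ℝ T] fun β => wave β t • b β) β := by
  simp only [convolution_def, ContinuousLinearMap.mul_apply', smul_mul_smul_comm,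
    ← wave_add_left, add_sub_cancel]
  exact (integral_smul _ _).symm

lemma integral_norm_convolution_le {a b : V → T} (ha : Integrable a) (hb : Integrable b) :
    ∫ β, ‖(a ⋆[ContinuousLinearMap.mul ℝ T] b) β‖ ≤ (∫ β, ‖a β‖) * ∫ β, ‖b β‖ := by
  have h := integral_convolution (ContinuousLinearMap.mul ℝ ℝ) ha.norm hb.norm
  rw [ContinuousLinearMap.mul_apply'] at h
  rw [← h]
  refine integral_mono_ae (ha.integrable_convolution _ hb).norm
    (ha.norm.integrable_convolution _ hb.norm) ?_
  filter_upwards [ha.norm.ae_convolution_exists (ContinuousLinearMap.mul ℝ ℝ) hb.norm] with β hβ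
  exact norm_integral_le_of_norm_le hβ (by filter_upwards with s using norm_mul_le _ _)

variable [CompleteSpace T]

variable (V T) in
/-- Fourier transforms of Bochner integrable functions with values in `T`. -/
noncomputable def integralClass : WienerClass V T where
  NormLE := IntegralNormLE
  zero := ⟨0, integrable_zero _ _ _, by simp, by simp⟩
  norm_apply_le := by
    rintro f C ⟨a, ha, hC, hf⟩ t
    rw [hf]
    refine (norm_integral_le_integral_norm _).trans (le_trans (le_of_eq ?_) hC)
    simp [norm_smul, norm_wave]
  smul := by
    rintro f C c ⟨a, ha, hC, hf⟩
    refine ⟨fun β => c • a β, ha.smul c, ?_, fun t => ?_⟩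
    · simp only [norm_smul, integral_const_mul]
      gcongr
    · simp only [hf, smul_comm _ c, integral_smul]
  mul := by
    rintro f g C D ⟨a, ha, hC, hf⟩ ⟨b, hb, hD, hg⟩
    refine ⟨a ⋆[ContinuousLinearMap.mul ℝ T] b, ha.integrable_convolution _ hb, ?_, fun t => ?_⟩
    · refine (integral_norm_convolution_le ha hb).trans (mul_le_mul hC hD ?_ ?_)
      · exact integral_nonneg fun _ => norm_nonneg _
      · exact (integral_nonneg fun _ => norm_nonneg _).trans hC
    · simp only [wave_smul_convolution]
      rw [integral_convolution _ (integrable_wave_smul ha t) (integrable_wave_smul hb t), hf, hg]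
      rfl
  mul_const := by
    rintro f C z ⟨a, ha, hC, hf⟩
    refine ⟨fun β => a β * z, ha.mul_const z, ?_, fun t => ?_⟩
    · calc ∫ β, ‖a β * z‖ ≤ ∫ β, ‖a β‖ * ‖z‖ :=
            integral_mono (ha.mul_const z).norm (ha.norm.mul_const _) fun β => norm_mul_le _ _
        _ ≤ C * ‖z‖ := by rw [integral_mul_const]; gcongr
    · simp only [hf, ← smul_mul_assoc]
      exact (integral_mul_const_of_integrable (integrable_wave_smul ha t)).symm
  tsum := by
    intro f C hf hC
    choose a ha haC hf using hf
    have hs : Summable fun n => ∫ β, ‖a n β‖ :=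
      hC.of_nonneg_of_le (fun n => integral_nonneg fun _ => norm_nonneg _) haC
    have h := integrable_tsum_of_summable_integral_norm ha hs
    refine ⟨fun β => ∑' n, a n β, h.1, h.2.trans (hs.tsum_le_tsum haC hC), fun t => ?_⟩
    simp only [hf]
    rw [(hasSum_integral_of_summable_integral_norm (fun n => integrable_wave_smul (ha n) t)
      (by simpa only [norm_smul, norm_wave, one_mul] using hs)).tsum_eq]
    simp only [tsum_const_smul'']

lemma integralClass_comp_sub {f : V → T} {C : ℝ} (hf : (integralClass V T).NormLE f C) (t₀ : V) :
    (integralClass V T).NormLE (fun t => f (t - t₀)) C := by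
  obtain ⟨a, ha, hC, hf⟩ := hf
  refine ⟨fun β => wave β (-t₀) • a β, integrable_wave_smul ha _, ?_, fun t => ?_⟩
  · simpa only [norm_smul, norm_wave, one_mul] using hC
  · simp only [hf, smul_smul, ← wave_add_right, sub_eq_add_neg]

omit [CompleteSpace T] in
lemma integral_inv_pow_smul_comp_inv_smul {F : Type*} [NormedAddCommGroup F] [NormedSpace ℝ F]
    (g : V → F) {l : ℝ} (hl : 0 < l) :
    ∫ β, (l ^ Module.finrank ℝ V)⁻¹ • g (l⁻¹ • β) = ∫ β, g β := by
  rw [integral_smul, Measure.integral_comp_inv_smul_of_nonneg _ _ hl.le, smul_smul,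
    inv_mul_cancel₀ (by positivity), one_smul]

lemma integralClass_comp_smul {f : V → T} {C : ℝ} (hf : (integralClass V T).NormLE f C) {l : ℝ}
    (hl : 0 < l) : (integralClass V T).NormLE (fun t => f (l • t)) C := by
  obtain ⟨a, ha, hC, hf⟩ := hf
  set d := (l ^ Module.finrank ℝ V)⁻¹ with hd
  have hd0 : 0 < d := by positivity
  refine ⟨fun β => d • a (l⁻¹ • β), (ha.comp_smul (inv_ne_zero hl.ne')).smul d, ?_, fun t => ?_⟩
  · simp only [norm_smul, Real.norm_of_nonneg hd0.le]
    exact (integral_inv_pow_smul_comp_inv_smul (fun β => ‖a β‖) hl).trans_le hC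
  · simp only [hf]
    rw [← integral_inv_pow_smul_comp_inv_smul _ hl]
    congr 1 with β
    rw [smul_comm, ← wave_smul_left, smul_inv_smul₀ hl.ne']

open FourierTransform SchwartzMap in
/-- Smooth compactly supported functions are Fourier transforms of integrable functions. -/
lemma exists_integralClass_of_hasCompactSupport {φ : V → ℂ} (hc : HasCompactSupport φ)
    (hs : ContDiff ℝ (⊤ : ℕ∞) φ) : ∃ C, (integralClass V T).NormLE (fun t => φ t • 1) C := by
  have hpi : (2 * Real.pi) ≠ 0 := by positivity
  let ψ : V → ℂ := fun w => φ ((2 * Real.pi) • w)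
  have hψc : HasCompactSupport ψ := hc.comp_smul hpi
  have hψs : ContDiff ℝ (⊤ : ℕ∞) ψ := hs.comp (contDiff_const_smul _)
  let η : 𝓢(V, ℂ) := 𝓕 (hψc.toSchwartzMap hψs)
  refine ⟨_, fun β => η β • 1, η.integrable.smul_const 1, le_rfl, fun t => ?_⟩
  have h1 : 𝓕⁻ η = hψc.toSchwartzMap hψs := fourierInv_fourier_eq _
  have h2 : φ t = 𝓕⁻ (η : V → ℂ) ((2 * Real.pi)⁻¹ • t) := by
    rw [← SchwartzMap.fourierInv_coe, h1]
    change _ = φ _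
    rw [smul_inv_smul₀ hpi]
  simp only []
  rw [h2, Real.fourierInv_eq', ← integral_smul_const]
  congr 1 with β
  rw [smul_smul, smul_eq_mul, wave, inner_smul_right, mul_inv_cancel_left₀ hpi]

end integralClass

/-! ### Dilations of Fourier transforms -/

section dilation

variable {V T : Type*} [NormedAddCommGroup V] [InnerProductSpace ℝ V] [FiniteDimensional ℝ V]
  [MeasurableSpace V] [BorelSpace V]

/-- Translation is continuous in `L¹`. -/
lemma continuous_integral_norm_comp_sub_sub {F : Type*} [NormedAddCommGroup F] {f : V → F}
    (hf : Integrable f) : Continuous fun u : V => ∫ β, ‖f (β - u) - f β‖ := by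
  have hmp (u : V) : MeasurePreserving (fun β : V => β - u) volume volume :=
    measurePreserving_sub_right volume u
  let τ : V → C(V, V) := fun u => ⟨fun β => β - u, by fun_prop⟩
  have hτ : Continuous τ := by
    refine ContinuousMap.continuous_of_continuous_uncurry _ ?_
    exact continuous_snd.sub continuous_fst
  have hc : Continuous fun u => Lp.compMeasurePreserving (τ u) (hmp u) (hf.toL1 f) :=
    Continuous.compMeasurePreservingLp continuous_const hτ hmp ENNReal.one_ne_top
  have heq (u : V) : ∫ β, ‖f (β - u) - f β‖ =
      ‖Lp.compMeasurePreserving (τ u) (hmp u) (hf.toL1 f) - hf.toL1 f‖ := by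
    rw [L1.norm_eq_integral_norm]
    refine integral_congr_ae ?_
    filter_upwards [Lp.coeFn_sub (Lp.compMeasurePreserving (τ u) (hmp u) (hf.toL1 f)) (hf.toL1 f),
      Lp.coeFn_compMeasurePreserving (hf.toL1 f) (hmp u), hf.coeFn_toL1,
      (hmp u).quasiMeasurePreserving.ae_eq_comp hf.coeFn_toL1] with β h1 h2 h3 h4
    rw [h1, Pi.sub_apply, h3]
    change _ = ‖(Lp.compMeasurePreserving (fun β : V => β - u) (hmp u) (hf.toL1 f)) β - f β‖
    rw [h2, h4]
    rfl
  simp only [heq]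
  exact (hc.sub continuous_const).norm

variable [NormedRing T]

lemma integral_norm_comp_sub_sub_le {f : V → T} (hf : Integrable f) (u : V) :
    ∫ β, ‖f (β - u) - f β‖ ≤ 2 * ∫ β, ‖f β‖ := by
  calc ∫ β, ‖f (β - u) - f β‖ ≤ ∫ β, (‖f (β - u)‖ + ‖f β‖) :=
        integral_mono ((hf.comp_sub_right u).sub hf).norm
          ((hf.comp_sub_right u).norm.add hf.norm) fun β => norm_sub_le _ _
    _ = 2 * ∫ β, ‖f β‖ := by
        rw [integral_add (hf.comp_sub_right u).norm hf.norm,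
          integral_sub_right_eq_self fun β => ‖f β‖, two_mul]

lemma integrable_mul_modulus {f g : V → T} (hf : Integrable f) (hg : Integrable g) (l : ℝ) :
    Integrable fun s => ‖g s‖ * ∫ β, ‖f (β - l • s) - f β‖ := by
  refine (hg.norm.mul_const (2 * ∫ β, ‖f β‖)).mono' ?_ (.of_forall fun s => ?_)
  · exact hg.norm.aestronglyMeasurable.mul ((continuous_integral_norm_comp_sub_sub hf).comp
      (continuous_const_smul l)).aestronglyMeasurable
  · rw [norm_mul, norm_norm, Real.norm_of_nonneg (integral_nonneg fun _ => norm_nonneg _)]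
    gcongr
    exact integral_norm_comp_sub_sub_le hf _

/-- The integral of `‖g s‖` against the `L¹` modulus of continuity of `f` at `l s` tends to `0`. -/
lemma tendsto_integral_mul_modulus {f g : V → T} (hf : Integrable f) (hg : Integrable g) :
    Filter.Tendsto (fun l : ℝ => ∫ s, ‖g s‖ * ∫ β, ‖f (β - l • s) - f β‖) (nhds 0) (nhds 0) := by
  have hω := continuous_integral_norm_comp_sub_sub hf
  have hlim := tendsto_integral_filter_of_dominated_convergence (μ := (volume : Measure V))
    (l := nhds (0 : ℝ)) (F := fun l s => ‖g s‖ * ∫ β, ‖f (β - l • s) - f β‖)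
    (f := fun _ => 0) (fun s => ‖g s‖ * (2 * ∫ β, ‖f β‖))
    (.of_forall fun l => (integrable_mul_modulus hf hg l).aestronglyMeasurable)
    (.of_forall fun l => .of_forall fun s => ?_) (hg.norm.mul_const _) (.of_forall fun s => ?_)
  · simpa using hlim
  · rw [norm_mul, norm_norm, Real.norm_of_nonneg (integral_nonneg fun _ => norm_nonneg _)]
    gcongr
    exact integral_norm_comp_sub_sub_le hf _
  · have h : Filter.Tendsto (fun l : ℝ => ‖g s‖ * ∫ β, ‖f (β - l • s) - f β‖) (nhds 0)
        (nhds (‖g s‖ * ∫ β, ‖f (β - (0 : ℝ) • s) - f β‖)) :=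
      ((hω.comp (continuous_id.smul continuous_const)).tendsto (0 : ℝ)).const_mul _
    simpa using h

lemma integrable_mul_comp_sub_smul {f g : V → T} (hf : Integrable f) (hg : Integrable g) (l : ℝ) :
    Integrable (fun p : V × V => g p.1 * f (p.2 - l • p.1)) (volume.prod volume) := by
  have hmp : MeasurePreserving (fun p : V × V => (p.1, p.2 - l • p.1))
      (volume.prod volume) (volume.prod volume) :=
    (MeasurePreserving.id volume).skew_product (g := fun s β => β - l • s)
      (by fun_prop) (.of_forall fun s => (measurePreserving_sub_right volume (l • s)).map_eq)
  exact hmp.integrable_comp_of_integrable (hg.mul_prod hf)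

variable [NormedAlgebra ℂ T] [CompleteSpace T]

/-- If `f` and `g` are Fourier transforms of integrable functions, then `(g(l t) - g(0)) f(t)` tends
to `0` in the norm of the class as `l → 0`. For `f` a cutoff this says that `g` is locally almost
constant; for `g` a cutoff it says that `f` is almost compactly supported. -/
lemma integralClass_comp_smul_sub_mul {f g : V → T} {C D ε : ℝ}
    (hf : (integralClass V T).NormLE f C) (hg : (integralClass V T).NormLE g D) (hε : 0 < ε) :
    ∃ l : ℝ, 0 < l ∧ (integralClass V T).NormLE (fun t => (g (l • t) - g 0) * f t) ε := by
  obtain ⟨a, ha, -, hf⟩ := hf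
  obtain ⟨b, hb, -, hg⟩ := hg
  have hsmall : ∀ᶠ l in nhdsWithin (0 : ℝ) (Set.Ioi 0),
      ∫ s, ‖b s‖ * ∫ β, ‖a (β - l • s) - a β‖ < ε :=
    ((tendsto_integral_mul_modulus ha hb).mono_left nhdsWithin_le_nhds).eventually_lt_const hε
  obtain ⟨l, hl, hl0⟩ := (hsmall.and self_mem_nhdsWithin).exists
  have hint : Integrable (fun p : V × V => b p.1 * (a (p.2 - l • p.1) - a p.2))
      (volume.prod volume) := by
    refine ((integrable_mul_comp_sub_smul ha hb l).sub
      (integrable_mul_comp_sub_smul ha hb 0)).congr (.of_forall fun p => ?_)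
    simp [mul_sub]
  have hat (u : V) : Integrable fun β => a (β - u) - a β := (ha.comp_sub_right u).sub ha
  refine ⟨l, hl0, fun β => ∫ s, b s * (a (β - l • s) - a β), hint.integral_prod_right, ?_,
    fun t => ?_⟩
  · calc ∫ β, ‖∫ s, b s * (a (β - l • s) - a β)‖
        ≤ ∫ β, ∫ s, ‖b s * (a (β - l • s) - a β)‖ :=
          integral_mono hint.integral_prod_right.norm hint.norm.integral_prod_right
            fun β => norm_integral_le_integral_norm _
      _ = ∫ s, ∫ β, ‖b s * (a (β - l • s) - a β)‖ :=
          (integral_integral_swap (f := fun s β => ‖b s * (a (β - l • s) - a β)‖) hint.norm).symm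
      _ ≤ ∫ s, ‖b s‖ * ∫ β, ‖a (β - l • s) - a β‖ := by
          refine integral_mono_of_nonneg (.of_forall fun s => integral_nonneg fun _ => norm_nonneg _)
            (integrable_mul_modulus ha hb l) (.of_forall fun s => ?_)
          simp only []
          rw [← integral_const_mul]
          exact integral_mono ((hat _).const_mul _).norm ((hat _).norm.const_mul _)
            fun β => norm_mul_le _ _
      _ ≤ ε := hl.le
  · have hwint : Integrable (fun p : V × V => wave p.2 t • (b p.1 * (a (p.2 - l • p.1) - a p.2)))
        (volume.prod volume) := by
      have hc : Continuous fun p : V × V => wave p.2 t :=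
        continuous_wave.comp (continuous_snd.prodMk continuous_const)
      refine hint.norm.mono' (hc.aestronglyMeasurable.smul hint.aestronglyMeasurable) ?_
      filter_upwards with p
      rw [norm_smul, norm_wave, one_mul]
    have htrans (u : V) : ∫ β, wave β t • a (β - u) = wave u t • ∫ β, wave β t • a β := by
      rw [← integral_sub_right_eq_self (fun β => wave β t • a β) u, ← integral_smul]
      congr 1 with β
      rw [smul_smul, ← wave_add_left, add_sub_cancel]
    have hinner (s : V) : ∫ β, wave β t • (b s * (a (β - l • s) - a β)) =
        (wave s (l • t) • b s - b s) * f t := by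
      have h1 := integrable_wave_smul (ha.comp_sub_right (l • s)) t
      have h2 := integrable_wave_smul ha t
      simp only [← mul_smul_comm, smul_sub]
      rw [integral_const_mul_of_integrable (f := fun β => wave β t • a (β - l • s) - wave β t • a β)
        (h1.sub h2), integral_sub h1 h2, htrans, ← hf, wave_smul_left, mul_sub, sub_mul,
        mul_smul_comm, smul_mul_assoc]
    simp only [← integral_smul]
    rw [← integral_integral_swap (f := fun s β => wave β t • (b s * (a (β - l • s) - a β))) hwint]
    simp only [hinner]
    rw [integral_mul_const_of_integrable (f := fun s => wave s (l • t) • b s - b s)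
      ((integrable_wave_smul hb _).sub hb),
      integral_sub (integrable_wave_smul hb _) hb, ← hg, hg 0]
    simp

end dilation

/-! ### The one-sided Wiener lemma for Fourier transforms -/

section integralTheorem

variable {V T : Type*} [NormedAddCommGroup V] [InnerProductSpace ℝ V] [FiniteDimensional ℝ V]
  [MeasurableSpace V] [BorelSpace V] [NormedRing T] [NormedAlgebra ℂ T] [CompleteSpace T]

lemma ContDiffBump.exists_integralClass (f : ContDiffBump (0 : V)) :
    ∃ C, (integralClass V T).NormLE (fun t => ((f t : ℝ) : ℂ) • 1) C :=
  exists_integralClass_of_hasCompactSupport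
    (f.hasCompactSupport.comp_left (g := fun x : ℝ => (x : ℂ)) rfl)
    (Complex.ofRealCLM.contDiff.comp f.contDiff)

/-- Outside a compact set, a nonzero constant plus a Fourier transform is invertible in the
class. -/
lemma integralClass_rightInvOn_compl_closedBall {f : V → T} {C : ℝ}
    (hf : (integralClass V T).NormLE f C) {c : ℂ} (hc : c ≠ 0) :
    ∃ R, (integralClass V T).RightInvOn (fun t => c • 1 + f t) (Metric.closedBall 0 R)ᶜ := by
  let ψ : ContDiffBump (0 : V) := ⟨1, 2, by norm_num, by norm_num⟩
  obtain ⟨D, hψ⟩ := ψ.exists_integralClass (T := T)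
  -- `(ψ(l t) - 1) f(t)` has small norm for small `l`, and equals `-f(t)` where `ψ(l t) = 0`
  obtain ⟨l, hl, hsmall⟩ := integralClass_comp_smul_sub_mul hf hψ
    (ε := ‖c‖ / 2) (by positivity)
  have hk := (integralClass V T).smul (-c⁻¹) hsmall
  have hlt : ‖-c⁻¹‖ * (‖c‖ / 2) < 1 := by
    rw [norm_neg, norm_inv]
    have : ‖c‖ ≠ 0 := norm_ne_zero_iff.2 hc
    field_simp
    norm_num
  obtain ⟨h, E, hh, hkh⟩ := (integralClass V T).exists_one_add_mul_one_add hk hlt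
  refine ⟨2 / l, c⁻¹, _, _, (integralClass V T).smul c⁻¹ hh, fun t ht => ?_⟩
  have h0 : ψ (l • t) = 0 := by
    apply ψ.zero_of_le_dist
    simp only [Set.mem_compl_iff, Metric.mem_closedBall, dist_zero_right, not_le,
      div_lt_iff₀ hl] at ht
    rw [dist_zero_right, norm_smul, Real.norm_of_nonneg hl.le, mul_comm]
    exact ht.le
  have h1 : ψ 0 = 1 := ψ.one_of_mem_closedBall (by simp [ψ])
  have h2 := hkh t
  rw [h0, h1] at h2
  rw [← smul_add, mul_smul_comm, ← smul_mul_assoc, ← h2, smul_add, inv_smul_smul₀ hc]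
  congr 2
  simp

/-- A constant plus a Fourier transform that has a right inverse at a point has one, in the class,
near that point. -/
lemma integralClass_local_rightInv {f : V → T} {C : ℝ} (hf : (integralClass V T).NormLE f C) {c : ℂ}
    {t₀ : V} {z : T} (hz : (c • 1 + f t₀) * z = 1) :
    ∃ s ∈ nhds t₀, ∀ A, (integralClass V T).RightInvOn (fun t => c • 1 + f t) A →
      (integralClass V T).RightInvOn (fun t => c • 1 + f t) (A ∪ s) := by
  let ψ : ContDiffBump (0 : V) := ⟨2, 3, by norm_num, by norm_num⟩
  let φ : ContDiffBump (0 : V) := ⟨1, 2, by norm_num, by norm_num⟩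
  obtain ⟨D, hψ⟩ := ψ.exists_integralClass (T := T)
  obtain ⟨D', hφ⟩ := φ.exists_integralClass (T := T)
  have hft : (integralClass V T).NormLE (fun t => f (t + t₀)) C := by
    simpa using integralClass_comp_sub hf (-t₀)
  obtain ⟨l, hl, hsmall⟩ := integralClass_comp_smul_sub_mul hψ hft
    (ε := 1 / (2 * (‖z‖ + 1))) (by positivity)
  -- rescale so that `f` itself appears, multiplied by a narrow cutoff centred at `t₀`
  have hk := (integralClass V T).mul_const z
    (integralClass_comp_sub (integralClass_comp_smul hsmall (inv_pos.2 hl)) t₀)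
  have hφ' := integralClass_comp_sub (integralClass_comp_smul hφ (inv_pos.2 hl)) t₀
  have hlt : 1 / (2 * (‖z‖ + 1)) * ‖z‖ < 1 := by
    have := norm_nonneg z
    rw [one_div_mul_eq_div, div_lt_one (by positivity)]
    linarith
  have hcell (t : V) (ht : ((φ (l⁻¹ • (t - t₀)) : ℝ) : ℂ) ≠ 0) : (c • 1 + f t) * z =
      1 + (f (l • l⁻¹ • (t - t₀) + t₀) - f (0 + t₀)) *
        ((ψ (l⁻¹ • (t - t₀)) : ℝ) : ℂ) • (1 : T) * z := by
    have h1 : ψ (l⁻¹ • (t - t₀)) = 1 := by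
      apply ψ.one_of_mem_closedBall
      by_contra hcon
      rw [Metric.mem_closedBall, not_le] at hcon
      exact ht (by rw [φ.zero_of_le_dist hcon.le, Complex.ofReal_zero])
    rw [h1, Complex.ofReal_one, one_smul, mul_one, smul_inv_smul₀ hl.ne', sub_add_cancel, zero_add,
      show c • 1 + f t = c • 1 + f t₀ + (f t - f t₀) by abel, add_mul, hz]
  obtain ⟨w, E, hw, hxw⟩ := WienerClass.exists_mul_eq_cutoff
    (φ := fun t => ((φ (l⁻¹ • (t - t₀)) : ℝ) : ℂ)) hφ' hk hlt hcell
  refine ⟨_, Metric.closedBall_mem_nhds t₀ hl, fun A hA => ?_⟩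
  refine (hA.union hφ' hw hxw).mono (Set.union_subset_union_right _ fun t ht => ?_)
  change ((φ (l⁻¹ • (t - t₀)) : ℝ) : ℂ) = 1
  rw [Complex.ofReal_eq_one]
  apply φ.one_of_mem_closedBall
  rw [mem_closedBall_zero_iff, norm_smul, norm_inv, Real.norm_of_nonneg hl.le,
    inv_mul_le_iff₀ hl, ← dist_eq_norm]
  simpa [φ] using ht

/-- Wiener's lemma for a nonzero constant plus the Fourier transform of an integrable function with
values in a Banach algebra, in one-sided form. -/
theorem exists_integral_rightInverse {a : V → T} (ha : Integrable a) {c : ℂ} (hc : c ≠ 0)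
    (hinv : ∀ t, ∃ z, (c • 1 + ∫ β, wave β t • a β) * z = 1) :
    ∃ (q : ℂ) (b : V → T), Integrable b ∧
      ∀ t, (c • 1 + ∫ β, wave β t • a β) * (q • 1 + ∫ β, wave β t • b β) = 1 := by
  have hf : (integralClass V T).NormLE (fun t => ∫ β, wave β t • a β) (∫ β, ‖a β‖) :=
    ⟨a, ha, le_rfl, fun t => rfl⟩
  obtain ⟨R, hR⟩ := integralClass_rightInvOn_compl_closedBall hf hc
  have hK := (isCompact_closedBall (0 : V) R).induction_on
    (p := fun s => ∀ A, (integralClass V T).RightInvOn (fun t => c • 1 + ∫ β, wave β t • a β) A →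
      (integralClass V T).RightInvOn (fun t => c • 1 + ∫ β, wave β t • a β) (A ∪ s))
    (fun A hA => by simpa using hA)
    (fun s t hst ht A hA => (ht A hA).mono (Set.union_subset_union_right _ hst))
    (fun s t hs ht A hA => by rw [← Set.union_assoc]; exact ht _ (hs A hA))
    (fun t _ => by
      obtain ⟨z, hz⟩ := hinv t
      obtain ⟨s, hs, h⟩ := integralClass_local_rightInv hf hz
      exact ⟨s, mem_nhdsWithin_of_mem_nhds hs, h⟩)
  obtain ⟨q, _, _, ⟨b, hb, -, hfb⟩, h⟩ := hK _ hR
  refine ⟨q, b, hb, fun t => ?_⟩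
  rw [← hfb]
  exact h t (by simp)

end integralTheorem

/-! ### Quaternion and octonion multiplication -/

section algebra

/-- The multiplication of the Cayley-Dickson algebra over an arbitrary coefficient ring, on
families of coefficients. -/
def cdMul {K : Type*} [Ring K] (v : ℕ) (x y : Fin (2 ^ v) → K) : Fin (2 ^ v) → K := fun k =>
  ∑ p : Fin (2 ^ v), cdSign v p (p ^^^ k : Fin (2 ^ v)) • (x p * y (p ^^^ k))

/-- The coefficients of the unit. -/
def cdOne {K : Type*} [Ring K] (v : ℕ) : Fin (2 ^ v) → K := fun k => if (k : ℕ) = 0 then 1 else 0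

/-- The conjugation that changes the sign of the imaginary coefficients. -/
def cdConj {K : Type*} [Ring K] {v : ℕ} (x : Fin (2 ^ v) → K) : Fin (2 ^ v) → K := fun k =>
  if (k : ℕ) = 0 then x k else -x k

lemma sum_fin_two_pow_two {M : Type*} [AddCommMonoid M] (f : Fin (2 ^ 2) → M) :
    ∑ p, f p = f 0 + f 1 + f 2 + f 3 := Fin.sum_univ_four f

lemma sum_fin_two_pow_three {M : Type*} [AddCommMonoid M] (f : Fin (2 ^ 3) → M) :
    ∑ p, f p = f 0 + f 1 + f 2 + f 3 + f 4 + f 5 + f 6 + f 7 := Fin.sum_univ_eight f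

lemma cdMul_two_apply {K : Type*} [Ring K] (x y : Fin (2 ^ 2) → K) :
    cdMul 2 x y 0 = x 0 * y 0 - x 1 * y 1 - x 2 * y 2 - x 3 * y 3 ∧
    cdMul 2 x y 1 = x 0 * y 1 + x 1 * y 0 + x 2 * y 3 - x 3 * y 2 ∧
    cdMul 2 x y 2 = x 0 * y 2 - x 1 * y 3 + x 2 * y 0 + x 3 * y 1 ∧
    cdMul 2 x y 3 = x 0 * y 3 + x 1 * y 2 - x 2 * y 1 + x 3 * y 0 := by
  refine ⟨?_, ?_, ?_, ?_⟩ <;>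
    rw [cdMul, sum_fin_two_pow_two] <;> simp [cdSign, cdConjSign, sub_eq_add_neg]

lemma cdMul_three_apply {K : Type*} [Ring K] (x y : Fin (2 ^ 3) → K) :
    cdMul 3 x y 0 = x 0 * y 0 - x 1 * y 1 - x 2 * y 2 - x 3 * y 3 -
      x 4 * y 4 - x 5 * y 5 - x 6 * y 6 - x 7 * y 7 ∧
    cdMul 3 x y 1 = x 0 * y 1 + x 1 * y 0 + x 2 * y 3 - x 3 * y 2 +
      x 4 * y 5 - x 5 * y 4 - x 6 * y 7 + x 7 * y 6 ∧
    cdMul 3 x y 2 = x 0 * y 2 - x 1 * y 3 + x 2 * y 0 + x 3 * y 1 +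
      x 4 * y 6 + x 5 * y 7 - x 6 * y 4 - x 7 * y 5 ∧
    cdMul 3 x y 3 = x 0 * y 3 + x 1 * y 2 - x 2 * y 1 + x 3 * y 0 +
      x 4 * y 7 - x 5 * y 6 + x 6 * y 5 - x 7 * y 4 ∧
    cdMul 3 x y 4 = x 0 * y 4 - x 1 * y 5 - x 2 * y 6 - x 3 * y 7 +
      x 4 * y 0 + x 5 * y 1 + x 6 * y 2 + x 7 * y 3 ∧
    cdMul 3 x y 5 = x 0 * y 5 + x 1 * y 4 - x 2 * y 7 + x 3 * y 6 -
      x 4 * y 1 + x 5 * y 0 - x 6 * y 3 + x 7 * y 2 ∧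
    cdMul 3 x y 6 = x 0 * y 6 + x 1 * y 7 + x 2 * y 4 - x 3 * y 5 -
      x 4 * y 2 + x 5 * y 3 + x 6 * y 0 - x 7 * y 1 ∧
    cdMul 3 x y 7 = x 0 * y 7 - x 1 * y 6 + x 2 * y 5 + x 3 * y 4 -
      x 4 * y 3 - x 5 * y 2 + x 6 * y 1 + x 7 * y 0 := by
  refine ⟨?_, ?_, ?_, ?_, ?_, ?_, ?_, ?_⟩ <;>
    rw [cdMul, sum_fin_two_pow_three] <;> simp [cdSign, cdConjSign, sub_eq_add_neg]

lemma cdMul_two_assoc {K : Type*} [Ring K] (x y z : Fin (2 ^ 2) → K) :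
    cdMul 2 (cdMul 2 x y) z = cdMul 2 x (cdMul 2 y z) := by
  ext k
  obtain ⟨h0, h1, h2, h3⟩ := cdMul_two_apply x y
  obtain ⟨e0, e1, e2, e3⟩ := cdMul_two_apply y z
  obtain ⟨a0, a1, a2, a3⟩ := cdMul_two_apply (cdMul 2 x y) z
  obtain ⟨b0, b1, b2, b3⟩ := cdMul_two_apply x (cdMul 2 y z)
  have hk : k = 0 ∨ k = 1 ∨ k = 2 ∨ k = 3 := by decide +revert
  rcases hk with rfl | rfl | rfl | rfl
  · rw [a0, b0, h0, h1, h2, h3, e0, e1, e2, e3]; noncomm_ring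
  · rw [a1, b1, h0, h1, h2, h3, e0, e1, e2, e3]; noncomm_ring
  · rw [a2, b2, h0, h1, h2, h3, e0, e1, e2, e3]; noncomm_ring
  · rw [a3, b3, h0, h1, h2, h3, e0, e1, e2, e3]; noncomm_ring

lemma cdMul_cdOne {K : Type*} [Ring K] {v : ℕ} (hv : v = 2 ∨ v = 3) (x : Fin (2 ^ v) → K) :
    cdMul v x (cdOne v) = x := by
  have h : ∀ k : Fin (2 ^ v), k ^^^ k = 0 ∧ cdSign v k (0 : Fin (2 ^ v)) = 1 ∧
      ∀ p : Fin (2 ^ v), p ^^^ k = 0 → p = k := by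
    rcases hv with rfl | rfl <;> decide
  ext k
  rw [cdMul, Finset.sum_eq_single k]
  · rw [(h k).1, (h k).2.1]
    simp [cdOne]
  · intro p _ hp
    have : (p ^^^ k : Fin (2 ^ v)).val ≠ 0 := fun h0 => hp ((h k).2.2 p (Fin.ext h0))
    simp only [cdOne, if_neg this, mul_zero, smul_zero]
  · simp

section comm

variable {K : Type*} [CommRing K]

lemma cdOne_cdMul_three (x : Fin (2 ^ 3) → K) : cdMul 3 (cdOne 3) x = x := by
  have h : ∀ k : Fin (2 ^ 3), cdSign 3 (0 : Fin (2 ^ 3)) (0 ^^^ k : Fin (2 ^ 3)) = 1 ∧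
      0 ^^^ k = k := by decide
  ext k
  rw [cdMul, Finset.sum_eq_single 0]
  · rw [(h k).1, (h k).2]
    simp [cdOne]
  · intro p _ hp
    have : p.val ≠ 0 := fun h0 => hp (Fin.ext h0)
    simp only [cdOne, if_neg this, zero_mul, smul_zero]
  · simp

lemma cdMul_smul {v : ℕ} (c : K) (x y : Fin (2 ^ v) → K) :
    cdMul v x (c • y) = c • cdMul v x y := by
  ext k
  simp only [cdMul, Pi.smul_apply, smul_eq_mul, Finset.mul_sum]
  exact Finset.sum_congr rfl fun p _ => by rw [mul_smul_comm, mul_left_comm]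

lemma smul_cdMul {v : ℕ} (c : K) (x y : Fin (2 ^ v) → K) :
    cdMul v (c • x) y = c • cdMul v x y := by
  ext k
  simp only [cdMul, Pi.smul_apply, smul_eq_mul, Finset.mul_sum]
  exact Finset.sum_congr rfl fun p _ => by rw [mul_smul_comm, mul_assoc]

lemma cdConj_cdConj {v : ℕ} (x : Fin (2 ^ v) → K) : cdConj (cdConj x) = x := by
  ext k; by_cases h : (k : ℕ) = 0 <;> simp only [cdConj, h, if_true, if_false, neg_neg]

lemma cdConj_smul {v : ℕ} (c : K) (x : Fin (2 ^ v) → K) : cdConj (c • x) = c • cdConj x := by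
  ext k
  by_cases h : (k : ℕ) = 0 <;>
    simp only [cdConj, h, if_true, if_false, Pi.smul_apply, smul_neg]

lemma sum_cdConj_sq {v : ℕ} (x : Fin (2 ^ v) → K) : ∑ j, cdConj x j ^ 2 = ∑ j, x j ^ 2 :=
  Finset.sum_congr rfl fun j _ => by
    by_cases h : (j : ℕ) = 0 <;> simp only [cdConj, h, if_true, if_false, neg_sq]

/-- In an octonion algebra, `(y x) x^* = y (x x^*)`, and `x x^*` is the scalar `∑ x_j²`. -/
lemma cdMul_three_cdConj (x y : Fin (2 ^ 3) → K) :
    cdMul 3 (cdMul 3 y x) (cdConj x) = (∑ j, x j ^ 2) • y := by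
  obtain ⟨h0, h1, h2, h3, h4, h5, h6, h7⟩ := cdMul_three_apply y x
  obtain ⟨a0, a1, a2, a3, a4, a5, a6, a7⟩ := cdMul_three_apply (cdMul 3 y x) (cdConj x)
  have c0 : cdConj x 0 = x 0 := rfl
  have hc {j : Fin (2 ^ 3)} (hj : j ≠ 0) : cdConj x j = -x j :=
    if_neg fun h => hj (Fin.ext h)
  have c1 := hc (j := 1) (by decide)
  have c2 := hc (j := 2) (by decide)
  have c3 := hc (j := 3) (by decide)
  have c4 := hc (j := 4) (by decide)
  have c5 := hc (j := 5) (by decide)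
  have c6 := hc (j := 6) (by decide)
  have c7 := hc (j := 7) (by decide)
  ext k
  have hk : k = 0 ∨ k = 1 ∨ k = 2 ∨ k = 3 ∨ k = 4 ∨ k = 5 ∨ k = 6 ∨ k = 7 := by decide +revert
  rw [sum_fin_two_pow_three, Pi.smul_apply, smul_eq_mul]
  rcases hk with rfl | rfl | rfl | rfl | rfl | rfl | rfl | rfl
  · rw [a0, h0, h1, h2, h3, h4, h5, h6, h7, c0, c1, c2, c3, c4, c5, c6, c7]; ring
  · rw [a1, h0, h1, h2, h3, h4, h5, h6, h7, c0, c1, c2, c3, c4, c5, c6, c7]; ring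
  · rw [a2, h0, h1, h2, h3, h4, h5, h6, h7, c0, c1, c2, c3, c4, c5, c6, c7]; ring
  · rw [a3, h0, h1, h2, h3, h4, h5, h6, h7, c0, c1, c2, c3, c4, c5, c6, c7]; ring
  · rw [a4, h0, h1, h2, h3, h4, h5, h6, h7, c0, c1, c2, c3, c4, c5, c6, c7]; ring
  · rw [a5, h0, h1, h2, h3, h4, h5, h6, h7, c0, c1, c2, c3, c4, c5, c6, c7]; ring
  · rw [a6, h0, h1, h2, h3, h4, h5, h6, h7, c0, c1, c2, c3, c4, c5, c6, c7]; ring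
  · rw [a7, h0, h1, h2, h3, h4, h5, h6, h7, c0, c1, c2, c3, c4, c5, c6, c7]; ring

/-- In an octonion algebra over a commutative ring, a left inverse `z` of `x` satisfies
`x^* = n(x) z`, where the norm `n(x) = x x^*` is then a unit; hence `(u z) x = u`. -/
lemma cdMul_three_cancel {x z : Fin (2 ^ 3) → K} (h : cdMul 3 z x = cdOne 3)
    (u : Fin (2 ^ 3) → K) : cdMul 3 (cdMul 3 u z) x = u := by
  set n := ∑ j, x j ^ 2 with hn
  have h1 : cdConj x = n • z := by rw [← cdMul_three_cdConj, h, cdOne_cdMul_three]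
  have h2 : x = n • cdConj z := by rw [← cdConj_smul, ← h1, cdConj_cdConj]
  have h3 : n * ∑ j, z j ^ 2 = 1 := by
    have h4 := cdMul_three_cdConj z (cdOne 3)
    rw [cdOne_cdMul_three] at h4
    have h5 := congrFun h 0
    rw [h2, cdMul_smul, h4] at h5
    simpa [cdOne] using h5
  have h6 : n • cdMul 3 (cdMul 3 u z) x = n • u := by
    have h7 := cdMul_three_cdConj (cdConj x) u
    rw [cdConj_cdConj, sum_cdConj_sq, h1, cdMul_smul, smul_cdMul] at h7
    exact h7
  have h8 := congrArg ((∑ j, z j ^ 2) • ·) h6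
  simpa only [smul_smul, mul_comm _ n, h3, one_smul] using h8

end comm

section CayleyDickson

variable {S : Type*} [NormedRing S] {v : ℕ}

lemma CayleyDickson.mul_apply (x y : CayleyDickson v S) (k : Fin (2 ^ v)) :
    (x * y) k = cdMul v x y k := rfl

/-- An octonion algebra with coefficients in `S` is alternative only if `S` is commutative: for
`A = s i_1 + t i_2` and `B = i_4` the coefficient of `i_7` in the left alternative law gives
`2 (s t - t s) = 0`. -/
lemma mul_comm_of_isAlternativeMul [NormedAlgebra ℝ S]
    (hR : IsAlternativeMul (CayleyDickson 3 S)) (s t : S) : s * t = t * s := by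
  let A : CayleyDickson 3 S := WithLp.toLp 2 fun k => if k = 1 then s else if k = 2 then t else 0
  let B : CayleyDickson 3 S := WithLp.toLp 2 fun k => if k = 4 then 1 else 0
  have h := congrArg (fun X : CayleyDickson 3 S => X 7) (hR A B).1
  simp only [CayleyDickson.mul_apply] at h
  have hAA (k : Fin (2 ^ 3)) : (A * A) k = cdMul 3 A A k := rfl
  have hAB (k : Fin (2 ^ 3)) : (A * B) k = cdMul 3 A B k := rfl
  obtain ⟨h0, h1, h2, h3, h4, h5, h6, h7⟩ := cdMul_three_apply A A
  obtain ⟨a0, a1, a2, a3, a4, a5, a6, a7⟩ := cdMul_three_apply A B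
  rw [(cdMul_three_apply (A * A).ofLp B).2.2.2.2.2.2.2,
    (cdMul_three_apply A (A * B).ofLp).2.2.2.2.2.2.2] at h
  simp only [hAA, hAB, h0, h1, h2, h3, h4, h5, h6, h7, a0, a1, a2, a3, a4, a5, a6, a7] at h
  simp [A, B] at h
  have h8 : (2 : ℝ) • (s * t - t * s) = 0 := by
    rw [two_smul]
    nth_rewrite 1 [h]
    abel
  exact sub_eq_zero.1 ((smul_eq_zero.1 h8).resolve_left two_ne_zero)

end CayleyDickson

end algebra

section complexified

variable {S : Type*} [NormedRing S] {v : ℕ}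

/-! ### The complexified algebra -/

lemma CayleyDickson.add_mul (x y z : CayleyDickson v S) : (x + y) * z = x * z + y * z := by
  ext k
  simp only [CayleyDickson.mul_apply, PiLp.add_apply, cdMul, _root_.add_mul, smul_add,
    Finset.sum_add_distrib]

lemma CayleyDickson.mul_add (x y z : CayleyDickson v S) : x * (y + z) = x * y + x * z := by
  ext k
  simp only [CayleyDickson.mul_apply, PiLp.add_apply, cdMul, _root_.mul_add, smul_add,
    Finset.sum_add_distrib]

lemma CayleyDickson.neg_mul (x y : CayleyDickson v S) : -x * y = -(x * y) := by
  ext k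
  simp only [CayleyDickson.mul_apply, PiLp.neg_apply, cdMul, _root_.neg_mul, smul_neg,
    Finset.sum_neg_distrib]

lemma CayleyDickson.mul_neg (x y : CayleyDickson v S) : x * -y = -(x * y) := by
  ext k
  simp only [CayleyDickson.mul_apply, PiLp.neg_apply, cdMul, _root_.mul_neg, smul_neg,
    Finset.sum_neg_distrib]

lemma CayleyDickson.sub_mul (x y z : CayleyDickson v S) : (x - y) * z = x * z - y * z := by
  rw [sub_eq_add_neg, CayleyDickson.add_mul, CayleyDickson.neg_mul, ← sub_eq_add_neg]

lemma CayleyDickson.mul_sub (x y z : CayleyDickson v S) : x * (y - z) = x * y - x * z := by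
  rw [sub_eq_add_neg, CayleyDickson.mul_add, CayleyDickson.mul_neg, ← sub_eq_add_neg]

lemma CayleyDickson.mul_zero (x : CayleyDickson v S) : x * 0 = 0 := by
  ext k
  simp only [CayleyDickson.mul_apply, PiLp.zero_apply, cdMul, MulZeroClass.mul_zero, smul_zero,
    Finset.sum_const_zero]

lemma CayleyDickson.smul_mul [NormedAlgebra ℝ S] (r : ℝ) (x y : CayleyDickson v S) :
    (r • x) * y = r • (x * y) := by
  ext k
  simp only [CayleyDickson.mul_apply, PiLp.smul_apply, cdMul, smul_mul_assoc, Finset.smul_sum]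
  exact Finset.sum_congr rfl fun p _ => smul_comm _ _ _

lemma CayleyDickson.mul_smul [NormedAlgebra ℝ S] (r : ℝ) (x y : CayleyDickson v S) :
    x * (r • y) = r • (x * y) := by
  ext k
  simp only [CayleyDickson.mul_apply, PiLp.smul_apply, cdMul, mul_smul_comm, Finset.smul_sum]
  exact Finset.sum_congr rfl fun p _ => smul_comm _ _ _

lemma CayleyDickson.norm_le_sum (x : CayleyDickson v S) : ‖x‖ ≤ ∑ k, ‖x k‖ := by
  refine abs_le_of_sq_le_sq' ?_ (Finset.sum_nonneg fun _ _ => norm_nonneg _) |>.2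
  rw [PiLp.norm_sq_eq_of_L2]
  exact Finset.sum_sq_le_sq_sum_of_nonneg fun _ _ => norm_nonneg _

lemma CayleyDickson.exists_norm_mul_le :
    ∃ C : ℝ, 0 ≤ C ∧ ∀ x y : CayleyDickson v S, ‖x * y‖ ≤ C * (‖x‖ * ‖y‖) := by
  refine ⟨∑ k : Fin (2 ^ v), ∑ p : Fin (2 ^ v), |(cdSign v p (p ^^^ k : Fin (2 ^ v)) : ℝ)|,
    by positivity, fun x y => ?_⟩
  rw [Finset.sum_mul]
  refine (CayleyDickson.norm_le_sum _).trans (Finset.sum_le_sum fun k _ => ?_)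
  rw [Finset.sum_mul, CayleyDickson.mul_apply]
  refine (norm_sum_le _ _).trans (Finset.sum_le_sum fun p _ => ?_)
  refine (norm_zsmul_le _ _).trans ?_
  rw [← Int.norm_eq_abs]
  gcongr
  exact (norm_mul_le _ _).trans (mul_le_mul (PiLp.norm_apply_le _ _) (PiLp.norm_apply_le _ _)
    (norm_nonneg _) (norm_nonneg _))

namespace Complexified

section basic

variable {R : Type*}

@[ext] lemma ext {X Y : Complexified R} (h₁ : X.fst = Y.fst) (h₂ : X.snd = Y.snd) : X = Y :=
  (WithLp.ofLp_injective 2) (Prod.ext h₁ h₂)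

@[simp] lemma fst_of [Zero R] (A : R) : (of A).fst = A := rfl

@[simp] lemma snd_of [Zero R] (A : R) : (of A).snd = 0 := rfl

lemma one_def [Zero R] [One R] : (1 : Complexified R) = of 1 := rfl

lemma fst_mul [Mul R] [Add R] [Sub R] (X Y : Complexified R) :
    (X * Y).fst = X.fst * Y.fst - X.snd * Y.snd := rfl

lemma snd_mul [Mul R] [Add R] [Sub R] (X Y : Complexified R) :
    (X * Y).snd = X.fst * Y.snd + X.snd * Y.fst := rfl

variable [NormedAddCommGroup R]

@[simp] lemma fst_add (X Y : Complexified R) : (X + Y).fst = X.fst + Y.fst := rfl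

@[simp] lemma snd_add (X Y : Complexified R) : (X + Y).snd = X.snd + Y.snd := rfl

lemma norm_fst_le (X : Complexified R) : ‖X.fst‖ ≤ ‖X‖ :=
  WithLp.norm_fst_le (p := 2) _ X

lemma norm_snd_le (X : Complexified R) : ‖X.snd‖ ≤ ‖X‖ :=
  WithLp.norm_snd_le (p := 2) _ X

lemma norm_le_add (X : Complexified R) : ‖X‖ ≤ ‖X.fst‖ + ‖X.snd‖ := by
  refine abs_le_of_sq_le_sq' ?_ (by positivity) |>.2
  have h : ‖X‖ ^ 2 = ‖X.fst‖ ^ 2 + ‖X.snd‖ ^ 2 := WithLp.prod_norm_sq_eq_of_L2 X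
  rw [h]
  nlinarith [norm_nonneg X.fst, norm_nonneg X.snd]

variable [NormedSpace ℝ R]

@[simp] lemma fst_smul (r : ℝ) (X : Complexified R) : (r • X).fst = r • X.fst := rfl

@[simp] lemma snd_smul (r : ℝ) (X : Complexified R) : (r • X).snd = r • X.snd := rfl

@[simp] lemma fst_csmul (z : ℂ) (X : Complexified R) :
    (z • X).fst = z.re • X.fst - z.im • X.snd := rfl

@[simp] lemma snd_csmul (z : ℂ) (X : Complexified R) :
    (z • X).snd = z.re • X.snd + z.im • X.fst := rfl

/-- The component `A` of `A + B 𝐢`, as a continuous linear map. -/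
noncomputable def fstL : Complexified R →L[ℝ] R :=
  LinearMap.mkContinuous ⟨⟨fst, fun _ _ => rfl⟩, fun _ _ => rfl⟩ 1
    fun X => by rw [one_mul]; exact norm_fst_le X

/-- The component `B` of `A + B 𝐢`, as a continuous linear map. -/
noncomputable def sndL : Complexified R →L[ℝ] R :=
  LinearMap.mkContinuous ⟨⟨snd, fun _ _ => rfl⟩, fun _ _ => rfl⟩ 1
    fun X => by rw [one_mul]; exact norm_snd_le X

/-- The map `(A, B) ↦ A + B 𝐢`, as a continuous linear map. -/
noncomputable def mkL : R × R →L[ℝ] Complexified R :=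
  LinearMap.mkContinuous ⟨⟨fun p => mk p.1 p.2, fun _ _ => rfl⟩, fun _ _ => rfl⟩ 2 fun p => by
    refine (norm_le_add _).trans ?_
    have h1 := _root_.norm_fst_le p
    have h2 := _root_.norm_snd_le p
    change ‖p.1‖ + ‖p.2‖ ≤ 2 * ‖p‖
    linarith

/-- The conjugation `A + B 𝐢 ↦ A - B 𝐢`. -/
noncomputable def conjL : Complexified R →L[ℝ] Complexified R :=
  mkL.comp (fstL.prod (-sndL))

@[simp] lemma fst_conjL (X : Complexified R) : (conjL X).fst = X.fst := rfl

@[simp] lemma snd_conjL (X : Complexified R) : (conjL X).snd = -X.snd := rfl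

lemma conjL_csmul (z : ℂ) (X : Complexified R) :
    conjL (z • X) = (starRingEnd ℂ z) • conjL X := by
  ext <;> simp [sub_eq_add_neg, add_comm]

end basic

lemma conjL_mul [NormedAlgebra ℝ S] (X Y : Complexified (CayleyDickson v S)) :
    conjL (X * Y) = conjL X * conjL Y := by
  ext1 <;> simp [fst_mul, snd_mul, CayleyDickson.neg_mul, CayleyDickson.mul_neg, add_comm]

lemma conjL_one [NormedAlgebra ℝ S] : conjL (1 : Complexified (CayleyDickson v S)) = 1 := by
  ext1 <;> simp [one_def]

lemma mul_one (hv : v = 2 ∨ v = 3) (X : Complexified (CayleyDickson v S)) : X * 1 = X := by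
  have h (A : CayleyDickson v S) : A * 1 = A := by
    ext k
    exact congrFun (cdMul_cdOne hv A) k
  ext1 <;> simp [fst_mul, snd_mul, one_def, h, CayleyDickson.mul_zero]

lemma mul_assoc_of_two (X Y Z : Complexified (CayleyDickson 2 S)) : X * Y * Z = X * (Y * Z) := by
  have h (A B C : CayleyDickson 2 S) : A * B * C = A * (B * C) := by
    ext k
    exact congrFun (cdMul_two_assoc A B C) k
  ext1 <;> simp only [fst_mul, snd_mul, CayleyDickson.mul_add, CayleyDickson.mul_sub,
    CayleyDickson.add_mul, CayleyDickson.sub_mul, h] <;> abel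

/-- Over a commutative ring of coefficients, a left inverse `Z` of an octonion `X` can be
cancelled by `X`: the complexification is the octonion algebra over `S ⊕ S 𝐢`. -/
lemma mul_mul_cancel_of_comm {S : Type*} [NormedCommRing S]
    {X Z : Complexified (CayleyDickson 3 S)} (h : Z * X = 1)
    (U : Complexified (CayleyDickson 3 S)) : U * Z * X = U := by
  let F : Complexified (CayleyDickson 3 S) → Fin (2 ^ 3) → QuadraticAlgebra S (-1) 0 :=
    fun X k => ⟨X.fst k, X.snd k⟩
  have hF : Function.Injective F := by
    intro X Y hXY
    ext k
    · exact congrArg QuadraticAlgebra.re (congrFun hXY k)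
    · exact congrArg QuadraticAlgebra.im (congrFun hXY k)
  -- `QuadraticAlgebra S (-1) 0` is `S ⊕ S 𝐢`, a commutative ring
  let re : QuadraticAlgebra S (-1) 0 →+ S := ⟨⟨QuadraticAlgebra.re, rfl⟩, fun _ _ => rfl⟩
  let im : QuadraticAlgebra S (-1) 0 →+ S := ⟨⟨QuadraticAlgebra.im, rfl⟩, fun _ _ => rfl⟩
  have hmul (X Y : Complexified (CayleyDickson 3 S)) : F (X * Y) = cdMul 3 (F X) (F Y) := by
    ext k
    · change (X.fst * Y.fst) k - (X.snd * Y.snd) k = re (cdMul 3 (F X) (F Y) k)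
      simp only [CayleyDickson.mul_apply, cdMul, map_sum, map_zsmul, ← Finset.sum_sub_distrib,
        ← smul_sub]
      refine Finset.sum_congr rfl fun p _ => congrArg _ ?_
      simp [re, F, sub_eq_add_neg]
    · change (X.fst * Y.snd) k + (X.snd * Y.fst) k = im (cdMul 3 (F X) (F Y) k)
      simp only [CayleyDickson.mul_apply, cdMul, map_sum, map_zsmul, ← Finset.sum_add_distrib,
        ← smul_add]
      refine Finset.sum_congr rfl fun p _ => congrArg _ ?_
      simp [im, F]
  have hone : F 1 = cdOne 3 := by
    ext k
    · change cdOne 3 k = re (cdOne 3 k)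
      by_cases hk : (k : ℕ) = 0
      · simp only [cdOne, hk, if_true]; rfl
      · simp only [cdOne, hk, if_false]; rfl
    · change 0 = im (cdOne 3 k)
      by_cases hk : (k : ℕ) = 0
      · simp only [cdOne, hk, if_true]; rfl
      · simp only [cdOne, hk, if_false]; rfl
  apply hF
  rw [hmul, hmul]
  exact cdMul_three_cancel (by rw [← hmul, h, hone]) _

/-- Right multiplication by `X` undoes right multiplication by a left inverse of `X`, although the
algebra need not be associative. -/
lemma mul_mul_cancel [NormedAlgebra ℝ S] (hv : v = 2 ∨ v = 3)
    (hR : IsAlternativeMul (CayleyDickson v S)) {X Z : Complexified (CayleyDickson v S)}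
    (h : Z * X = 1) (U : Complexified (CayleyDickson v S)) : U * Z * X = U := by
  rcases hv with rfl | rfl
  · rw [mul_assoc_of_two, h, mul_one (Or.inl rfl)]
  · exact @mul_mul_cancel_of_comm S
      { (inferInstance : NormedRing S) with mul_comm := mul_comm_of_isAlternativeMul hR } X Z h U

end Complexified

end complexified

/-! ### An equivalent complex norm on the complexification -/

section complexStructure

/-- The complexification of `R` as the space of real linear maps `ℂ → R`, where `A + B 𝐢` is the
map `w ↦ (Re w) A - (Im w) B`. Its operator norm is equivalent to the norm of `Complexified R` and,
unlike the latter, is homogeneous for the multiplication by complex numbers. -/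
def ComplexMaps (R : Type*) [NormedAddCommGroup R] [NormedSpace ℝ R] : Type _ := ℂ →L[ℝ] R

variable {R : Type*} [NormedAddCommGroup R] [NormedSpace ℝ R]

namespace ComplexMaps

noncomputable instance : NormedAddCommGroup (ComplexMaps R) :=
  inferInstanceAs (NormedAddCommGroup (ℂ →L[ℝ] R))

instance [CompleteSpace R] : CompleteSpace (ComplexMaps R) :=
  inferInstanceAs (CompleteSpace (ℂ →L[ℝ] R))

/-- The underlying real linear map. -/
def toCLM (f : ComplexMaps R) : ℂ →L[ℝ] R := f

noncomputable instance : Module ℂ (ComplexMaps R) where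
  smul c f := (f.toCLM.comp (ContinuousLinearMap.mul ℝ ℂ c) : ℂ →L[ℝ] R)
  one_smul f := by
    refine ContinuousLinearMap.ext fun w => ?_
    change f.toCLM (1 * w) = f.toCLM w
    rw [one_mul]
  mul_smul c d f := by
    refine ContinuousLinearMap.ext fun w => ?_
    change f.toCLM (c * d * w) = f.toCLM (d * (c * w))
    rw [mul_comm c d, mul_assoc]
  smul_zero c := rfl
  smul_add c f g := rfl
  add_smul c d f := by
    refine ContinuousLinearMap.ext fun w => ?_
    change f.toCLM ((c + d) * w) = f.toCLM (c * w) + f.toCLM (d * w)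
    rw [add_mul, map_add]
  zero_smul f := by
    refine ContinuousLinearMap.ext fun w => ?_
    change f.toCLM (0 * w) = 0
    rw [zero_mul, map_zero]

lemma toCLM_smul_apply (c : ℂ) (f : ComplexMaps R) (w : ℂ) :
    (c • f).toCLM w = f.toCLM (c * w) := rfl

noncomputable instance : NormedSpace ℂ (ComplexMaps R) where
  norm_smul_le c f := by
    refine ContinuousLinearMap.opNorm_le_bound _ (by positivity) fun w => ?_
    change ‖f.toCLM (c * w)‖ ≤ ‖c‖ * ‖f.toCLM‖ * ‖w‖
    refine (f.toCLM.le_opNorm _).trans_eq ?_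
    rw [norm_mul]
    ring

lemma toCLM_real_smul_apply (r : ℝ) (f : ComplexMaps R) (w : ℂ) :
    (r • f).toCLM w = r • f.toCLM w := by
  change f.toCLM ((r : ℂ) * w) = _
  rw [← Complex.real_smul, map_smul]

end ComplexMaps

namespace Complexified

/-- The identification of the complexification with the real linear maps `ℂ → R`. -/
noncomputable def equivMaps : Complexified R ≃L[ℝ] ComplexMaps R :=
  LinearEquiv.toContinuousLinearEquivOfBounds
    { toFun := fun X =>
        (Complex.reCLM.smulRight X.fst - Complex.imCLM.smulRight X.snd : ℂ →L[ℝ] R)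
      invFun := fun f => mk (f.toCLM 1) (-f.toCLM Complex.I)
      map_add' := fun X Y => by
        refine ContinuousLinearMap.ext fun w => ?_
        change w.re • (X.fst + Y.fst) - w.im • (X.snd + Y.snd) =
          (w.re • X.fst - w.im • X.snd) + (w.re • Y.fst - w.im • Y.snd)
        simp only [smul_add]
        abel
      map_smul' := fun r X => by
        refine ContinuousLinearMap.ext fun w => ?_
        refine Eq.trans ?_ (ComplexMaps.toCLM_real_smul_apply r _ w).symm
        change w.re • r • X.fst - w.im • r • X.snd = r • (w.re • X.fst - w.im • X.snd)
        rw [smul_sub, smul_comm r, smul_comm r]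
      left_inv := fun X => by
        ext1
        · change (1 : ℂ).re • X.fst - (1 : ℂ).im • X.snd = X.fst
          simp
        · change -(Complex.I.re • X.fst - Complex.I.im • X.snd) = X.snd
          simp
      right_inv := fun f => by
        refine ContinuousLinearMap.ext fun w => ?_
        change w.re • f.toCLM 1 - w.im • -f.toCLM Complex.I = f.toCLM w
        rw [smul_neg, sub_neg_eq_add, ← map_smul, ← map_smul, ← map_add]
        congr 1
        apply Complex.ext <;> simp }
    2 2
    (fun X => by
      refine ContinuousLinearMap.opNorm_le_bound _ (by positivity) fun w => ?_
      change ‖w.re • X.fst - w.im • X.snd‖ ≤ _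
      refine (norm_sub_le _ _).trans ?_
      rw [norm_smul, norm_smul]
      have h1 := mul_le_mul (Complex.abs_re_le_norm w) (norm_fst_le X) (norm_nonneg _)
        (norm_nonneg _)
      have h2 := mul_le_mul (Complex.abs_im_le_norm w) (norm_snd_le X) (norm_nonneg _)
        (norm_nonneg _)
      rw [Real.norm_eq_abs, Real.norm_eq_abs]
      linarith)
    (fun f => by
      refine (norm_le_add _).trans ?_
      change ‖f.toCLM 1‖ + ‖-f.toCLM Complex.I‖ ≤ 2 * ‖f.toCLM‖
      have h1 := f.toCLM.le_opNorm 1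
      have h2 := f.toCLM.le_opNorm Complex.I
      rw [norm_one] at h1
      rw [Complex.norm_I] at h2
      rw [norm_neg]
      linarith)

lemma toCLM_equivMaps_apply (X : Complexified R) (w : ℂ) :
    (equivMaps X).toCLM w = w.re • X.fst - w.im • X.snd := rfl

lemma equivMaps_csmul (c : ℂ) (X : Complexified R) : equivMaps (c • X) = c • equivMaps X := by
  refine ContinuousLinearMap.ext fun w => ?_
  refine Eq.trans ?_ (ComplexMaps.toCLM_smul_apply c _ w).symm
  refine (toCLM_equivMaps_apply _ w).trans ?_
  rw [toCLM_equivMaps_apply, fst_csmul, snd_csmul, Complex.mul_re, Complex.mul_im]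
  module

lemma equivMaps_symm_csmul (c : ℂ) (f : ComplexMaps R) :
    equivMaps.symm (c • f) = c • equivMaps.symm f := by
  rw [ContinuousLinearEquiv.symm_apply_eq, equivMaps_csmul,
    ContinuousLinearEquiv.apply_symm_apply]

section wave

variable {V : Type*} [NormedAddCommGroup V] [InnerProductSpace ℝ V]

lemma summable_wave_csmul [CompleteSpace R] {A : ℕ → Complexified R} (hA : Summable fun n => ‖A n‖)
    (β : ℕ → V) (t : V) : Summable fun n => wave (β n) t • A n := by
  refine (equivMaps (R := R)).summable.1 ?_
  simp only [equivMaps_csmul]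
  refine Summable.of_norm ?_
  simp only [norm_smul, norm_wave, one_mul]
  refine .of_nonneg_of_le (fun _ => norm_nonneg _)
    (fun n => (equivMaps (R := R)).toContinuousLinearMap.le_opNorm (A n)) (hA.mul_left _)

variable [FiniteDimensional ℝ V] [MeasurableSpace V] [BorelSpace V]

lemma integrable_wave_csmul {A : V → Complexified R} (hA : Integrable A) (t : V) :
    Integrable fun β => wave β t • A β := by
  refine (equivMaps (R := R)).integrable_comp_iff.1 ?_
  simp only [equivMaps_csmul]
  exact integrable_wave_smul ((equivMaps (R := R)).integrable_comp_iff.2 hA) t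

end wave

end Complexified

end complexStructure

/-! ### Left inverses through right multiplication operators -/

section transfer

namespace Complexified

variable {S : Type*} [NormedRing S] [NormedAlgebra ℝ S] {v : ℕ}

local notation "𝓒" => Complexified (CayleyDickson v S)

local notation "𝓔" => ComplexMaps (CayleyDickson v S)

omit [NormedAlgebra ℝ S] in
lemma add_mul (X Y Z : 𝓒) : (X + Y) * Z = X * Z + Y * Z := by
  ext1 <;> simp only [fst_mul, snd_mul, fst_add, snd_add, CayleyDickson.add_mul] <;> abel

omit [NormedAlgebra ℝ S] in
lemma mul_add (X Y Z : 𝓒) : X * (Y + Z) = X * Y + X * Z := by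
  ext1 <;> simp only [fst_mul, snd_mul, fst_add, snd_add, CayleyDickson.mul_add] <;> abel

lemma csmul_mul (c : ℂ) (X Y : 𝓒) : (c • X) * Y = c • (X * Y) := by
  ext1 <;> simp only [fst_mul, snd_mul, fst_csmul, snd_csmul, CayleyDickson.sub_mul,
    CayleyDickson.add_mul, CayleyDickson.smul_mul] <;> module

lemma mul_csmul (c : ℂ) (X Y : 𝓒) : X * (c • Y) = c • (X * Y) := by
  ext1 <;> simp only [fst_mul, snd_mul, fst_csmul, snd_csmul, CayleyDickson.mul_sub,
    CayleyDickson.mul_add, CayleyDickson.mul_smul] <;> module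

lemma real_smul_mul (r : ℝ) (X Y : 𝓒) : (r • X) * Y = r • (X * Y) := by
  ext1 <;> simp only [fst_mul, snd_mul, fst_smul, snd_smul, CayleyDickson.smul_mul, smul_add,
    smul_sub]

omit [NormedAlgebra ℝ S] in
lemma exists_norm_mul_le : ∃ C : ℝ, 0 ≤ C ∧ ∀ X Y : 𝓒, ‖X * Y‖ ≤ C * (‖X‖ * ‖Y‖) := by
  obtain ⟨C, hC, h⟩ := CayleyDickson.exists_norm_mul_le (S := S) (v := v)
  have key {A B : CayleyDickson v S} {X Y : 𝓒} (hA : ‖A‖ ≤ ‖X‖) (hB : ‖B‖ ≤ ‖Y‖) :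
      ‖A * B‖ ≤ C * (‖X‖ * ‖Y‖) :=
    (h A B).trans (mul_le_mul_of_nonneg_left (mul_le_mul hA hB (norm_nonneg _) (norm_nonneg _)) hC)
  refine ⟨4 * C, by positivity, fun X Y => (norm_le_add _).trans ?_⟩
  rw [fst_mul, snd_mul]
  linarith [norm_sub_le (X.fst * Y.fst) (X.snd * Y.snd),
    norm_add_le (X.fst * Y.snd) (X.snd * Y.fst), key (norm_fst_le X) (norm_fst_le Y),
    key (norm_snd_le X) (norm_snd_le Y), key (norm_fst_le X) (norm_snd_le Y),
    key (norm_snd_le X) (norm_fst_le Y)]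

variable (S v) in
/-- The right multiplications, as bounded complex linear operators. Unlike the elements themselves,
these form an associative complex Banach algebra. -/
noncomputable def rightMul : 𝓔 →L[ℂ] 𝓔 →L[ℂ] 𝓔 :=
  LinearMap.mkContinuousOfExistsBound₂
    (LinearMap.mk₂ ℂ (fun u w => equivMaps (equivMaps.symm w * equivMaps.symm u))
      (fun u u' w => by rw [map_add, mul_add, map_add])
      (fun c u w => by rw [equivMaps_symm_csmul, mul_csmul, equivMaps_csmul])
      (fun u w w' => by rw [map_add, add_mul, map_add])
      (fun c u w => by rw [equivMaps_symm_csmul, csmul_mul, equivMaps_csmul]))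
    (by
      obtain ⟨C, hC, h⟩ := exists_norm_mul_le (S := S) (v := v)
      let e : 𝓒 →L[ℝ] 𝓔 := (equivMaps (R := CayleyDickson v S)).toContinuousLinearMap
      let e' : 𝓔 →L[ℝ] 𝓒 := (equivMaps (R := CayleyDickson v S)).symm.toContinuousLinearMap
      refine ⟨‖e‖ * (C * (‖e'‖ * ‖e'‖)), fun u w => ?_⟩
      change ‖e (e' w * e' u)‖ ≤ _
      calc ‖e (e' w * e' u)‖ ≤ ‖e‖ * (C * (‖e' w‖ * ‖e' u‖)) :=
            (e.le_opNorm _).trans (by gcongr; exact h _ _)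
        _ ≤ ‖e‖ * (C * ((‖e'‖ * ‖w‖) * (‖e'‖ * ‖u‖))) := by
            gcongr <;> exact e'.le_opNorm _
        _ = ‖e‖ * (C * (‖e'‖ * ‖e'‖)) * ‖u‖ * ‖w‖ := by ring)

lemma rightMul_equivMaps (X Y : 𝓒) :
    rightMul S v (equivMaps X) (equivMaps Y) = equivMaps (Y * X) := by
  change equivMaps (equivMaps.symm (equivMaps Y) * equivMaps.symm (equivMaps X)) = _
  rw [ContinuousLinearEquiv.symm_apply_apply, ContinuousLinearEquiv.symm_apply_apply]

lemma rightMul_csmul_one (hv : v = 2 ∨ v = 3) (c : ℂ) :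
    rightMul S v (equivMaps (c • 1)) = c • 1 := by
  ext1 w
  obtain ⟨Y, rfl⟩ := equivMaps.surjective w
  rw [rightMul_equivMaps, mul_csmul, mul_one hv, equivMaps_csmul]
  rfl

/-- Right multiplication turns a left inverse into a right inverse. -/
lemma rightMul_mul_rightMul (hv : v = 2 ∨ v = 3) (hR : IsAlternativeMul (CayleyDickson v S))
    {X Z : 𝓒} (h : Z * X = 1) :
    rightMul S v (equivMaps X) * rightMul S v (equivMaps Z) = 1 := by
  ext1 w
  obtain ⟨Y, rfl⟩ := equivMaps.surjective w
  rw [mul_apply_eq_comp, rightMul_equivMaps, rightMul_equivMaps,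
    mul_mul_cancel hv hR h]
  rfl

/-- Conversely, a right inverse of a right multiplication yields a left inverse, namely the image
of the unit. -/
lemma mul_eq_one_of_rightMul {X : 𝓒} {z : 𝓔 →L[ℂ] 𝓔}
    (h : rightMul S v (equivMaps X) * z = 1) {Y : 𝓒} (hY : z (equivMaps 1) = equivMaps Y) :
    Y * X = 1 := by
  have h1 := congrArg (fun f : 𝓔 →L[ℂ] 𝓔 => f (equivMaps 1)) h
  rw [mul_apply_eq_comp, hY, rightMul_equivMaps] at h1
  exact equivMaps.injective h1

variable {V : Type*} [NormedAddCommGroup V] [InnerProductSpace ℝ V] [CompleteSpace S]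

omit [CompleteSpace S] in
lemma equivMaps_tsum_wave {A : ℕ → 𝓒} (β : ℕ → V) (t : V) :
    equivMaps (∑' n, wave (β n) t • A n) = ∑' n, wave (β n) t • equivMaps (A n) := by
  rw [ContinuousLinearEquiv.map_tsum]
  simp only [equivMaps_csmul]

lemma rightMul_tsum_wave {A : ℕ → 𝓒} (hA : Summable fun n => ‖A n‖) (β : ℕ → V) (t : V) :
    rightMul S v (equivMaps (∑' n, wave (β n) t • A n)) =
      ∑' n, wave (β n) t • rightMul S v (equivMaps (A n)) := by
  rw [equivMaps_tsum_wave, ContinuousLinearMap.map_tsum]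
  · simp only [map_smul]
  · simpa only [Function.comp_def, equivMaps_csmul] using
      (equivMaps (R := CayleyDickson v S)).summable.2 (summable_wave_csmul hA β t)

/-- Wiener's lemma for series with coefficients in the complexified algebra: the operator form
`exists_series_rightInverse`, evaluated at the unit. -/
lemma exists_series_leftInverse (hv : v = 2 ∨ v = 3) (hR : IsAlternativeMul (CayleyDickson v S))
    {A : ℕ → 𝓒} {β : ℕ → V} (hA : Summable fun n => ‖A n‖) {z : V → 𝓒}
    (hz : ∀ t, z t * (∑' n, wave (β n) t • A n) = 1) {C : ℝ} (hC : ∀ t, ‖z t‖ ≤ C) :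
    ∃ (B : ℕ → 𝓒) (τ : ℕ → V), (Summable fun n => ‖B n‖) ∧
      ∀ t, (∑' n, wave (τ n) t • B n) * (∑' n, wave (β n) t • A n) = 1 := by
  let e : 𝓒 →L[ℝ] 𝓔 := (equivMaps (R := CayleyDickson v S)).toContinuousLinearMap
  let e' : 𝓔 →L[ℝ] 𝓒 := (equivMaps (R := CayleyDickson v S)).symm.toContinuousLinearMap
  have ha : Summable fun n => ‖rightMul S v (e (A n))‖ := by
    refine .of_nonneg_of_le (fun _ => norm_nonneg _)
      (fun n => ((rightMul S v).le_opNorm _).trans ?_) ((hA.mul_left ‖e‖).mul_left ‖rightMul S v‖)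
    gcongr
    exact e.le_opNorm _
  obtain ⟨b, τ, hb, hbt⟩ := exists_series_rightInverse (β := β) ha
    (z := fun t => rightMul S v (e (z t)))
    (fun t => by
      rw [← rightMul_mul_rightMul hv hR (hz t), rightMul_tsum_wave hA]
      rfl)
    (C := ‖rightMul S v‖ * (‖e‖ * C))
    (fun t => ((rightMul S v).le_opNorm _).trans <| by
      gcongr
      exact (e.le_opNorm _).trans (by gcongr; exact hC t))
  have hB : Summable fun n => ‖e' (b n (equivMaps 1))‖ := by
    refine .of_nonneg_of_le (fun _ => norm_nonneg _) (fun n => (e'.le_opNorm _).trans ?_)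
      ((hb.mul_right ‖equivMaps (1 : 𝓒)‖).mul_left ‖e'‖)
    gcongr
    exact (b n).le_opNorm _
  refine ⟨fun n => e' (b n (equivMaps 1)), τ, hB, fun t => ?_⟩
  refine mul_eq_one_of_rightMul (z := ∑' n, wave (τ n) t • b n) ?_ ?_
  · rw [rightMul_tsum_wave hA]
    exact hbt t
  · rw [equivMaps_tsum_wave]
    have h := (ContinuousLinearMap.apply ℂ 𝓔 (equivMaps (1 : 𝓒))).map_tsum
      (summable_wave_smul τ hb t)
    refine h.trans (tsum_congr fun n => ?_)
    change wave (τ n) t • b n (equivMaps 1) = wave (τ n) t •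
      equivMaps (equivMaps.symm (b n (equivMaps (1 : 𝓒))))
    rw [ContinuousLinearEquiv.apply_symm_apply]

variable [FiniteDimensional ℝ V] [MeasurableSpace V] [BorelSpace V]

omit [CompleteSpace S] in
lemma equivMaps_integral_wave {A : V → 𝓒} (t : V) :
    equivMaps (∫ β, wave β t • A β) = ∫ β, wave β t • equivMaps (A β) := by
  rw [← ContinuousLinearEquiv.integral_comp_comm]
  simp only [equivMaps_csmul]

lemma rightMul_integral_wave {A : V → 𝓒} (hA : Integrable A) (t : V) :
    rightMul S v (equivMaps (∫ β, wave β t • A β)) =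
      ∫ β, wave β t • rightMul S v (equivMaps (A β)) := by
  rw [equivMaps_integral_wave, ← ContinuousLinearMap.integral_comp_comm]
  · simp only [map_smul]
  · exact integrable_wave_smul ((equivMaps (R := CayleyDickson v S)).integrable_comp_iff.2 hA) t

/-- Wiener's lemma for a constant plus a Fourier transform with values in the complexified algebra:
the operator form `exists_integral_rightInverse`, evaluated at the unit. -/
lemma exists_integral_leftInverse (hv : v = 2 ∨ v = 3) (hR : IsAlternativeMul (CayleyDickson v S))
    {A : V → 𝓒} (hA : Integrable A) {c : ℂ} (hc : c ≠ 0)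
    (hz : ∀ t, ∃ z : 𝓒, z * (c • 1 + ∫ β, wave β t • A β) = 1) :
    ∃ (q : ℂ) (B : V → 𝓒), Integrable B ∧
      ∀ t, (q • 1 + ∫ β, wave β t • B β) * (c • 1 + ∫ β, wave β t • A β) = 1 := by
  have ha : Integrable fun β => equivMaps (A β) :=
    (equivMaps (R := CayleyDickson v S)).integrable_comp_iff.2 hA
  have hx (t : V) : rightMul S v (equivMaps (c • 1 + ∫ β, wave β t • A β)) =
      c • 1 + ∫ β, wave β t • rightMul S v (equivMaps (A β)) := by
    rw [map_add, map_add, rightMul_csmul_one hv, rightMul_integral_wave hA]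
  obtain ⟨q, b, hb, hbt⟩ := exists_integral_rightInverse ((rightMul S v).integrable_comp ha) hc
    (fun t => by
      obtain ⟨z, hz⟩ := hz t
      exact ⟨rightMul S v (equivMaps z), by
        rw [← hx, rightMul_mul_rightMul hv hR hz]⟩)
  let ev := ContinuousLinearMap.apply ℂ 𝓔 (equivMaps (1 : 𝓒))
  have hB : Integrable fun β => (equivMaps (R := CayleyDickson v S)).symm (ev (b β)) :=
    (equivMaps (R := CayleyDickson v S)).symm.integrable_comp_iff.2 (ev.integrable_comp hb)
  refine ⟨q, _, hB, fun t => ?_⟩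
  refine mul_eq_one_of_rightMul (z := q • 1 + ∫ β, wave β t • b β) ?_ ?_
  · rw [hx]
    exact hbt t
  · rw [map_add, equivMaps_integral_wave, equivMaps_csmul]
    change q • equivMaps 1 + ev (∫ β, wave β t • b β) = _
    rw [← ev.integral_comp_comm (integrable_wave_smul hb t)]
    simp only [map_smul, ContinuousLinearEquiv.apply_symm_apply]

end Complexified

end transfer

/-! ### Real coefficients -/

section realCoefficients

namespace Complexified

section conj

variable {R : Type*} [NormedAddCommGroup R] [NormedSpace ℝ R]

/-- The inclusion `A ↦ A + 0 𝐢`, as a continuous linear map. -/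
noncomputable def ofL : R →L[ℝ] Complexified R := mkL.comp (ContinuousLinearMap.inl ℝ R R)

omit [NormedSpace ℝ R] in
lemma norm_of_le (A : R) : ‖of A‖ ≤ ‖A‖ := by
  simpa using norm_le_add (of A)

lemma conjL_of (A : R) : conjL (of A) = of A := by
  ext <;> simp

/-- The real part `A` of `A + B 𝐢` as the mean of `A + B 𝐢` and its conjugate. -/
lemma half_smul_add_conjL (X : Complexified R) : (2⁻¹ : ℝ) • (X + conjL X) = of X.fst := by
  ext1
  · simp only [fst_smul, fst_add, fst_conjL, fst_of]
    module
  · simp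

variable {V : Type*} [NormedAddCommGroup V] [InnerProductSpace ℝ V]

lemma conjL_wave_csmul (β t : V) (X : Complexified R) :
    conjL (wave β (-t) • X) = wave β t • conjL X := by
  rw [conjL_csmul, wave_neg_right, Complex.conj_conj]

lemma real_smul_csmul (r : ℝ) (c : ℂ) (X : Complexified R) : r • c • X = c • r • X := by
  ext1 <;> simp only [fst_smul, snd_smul, fst_csmul, snd_csmul] <;> module

lemma csmul_add (c : ℂ) (X Y : Complexified R) : c • (X + Y) = c • X + c • Y := by
  ext1 <;> simp only [fst_add, snd_add, fst_csmul, snd_csmul] <;> module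

lemma csmul_of_fst (c : ℂ) (X : Complexified R) :
    c • of X.fst = (2⁻¹ : ℝ) • (c • X + c • conjL X) := by
  rw [← half_smul_add_conjL, ← csmul_add, real_smul_csmul]

/-- Taking the real parts of the coefficients of a series amounts to averaging the series with its
conjugate at the opposite point. -/
lemma tsum_wave_of_fst [CompleteSpace R] {B : ℕ → Complexified R} (hB : Summable fun n => ‖B n‖)
    (τ : ℕ → V) (t : V) :
    ∑' n, wave (τ n) t • of (B n).fst =
      (2⁻¹ : ℝ) • ((∑' n, wave (τ n) t • B n) + conjL (∑' n, wave (τ n) (-t) • B n)) := by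
  have h := conjL.summable (summable_wave_csmul hB τ (-t))
  rw [conjL.map_tsum (summable_wave_csmul hB τ (-t)),
    ← (summable_wave_csmul hB τ t).tsum_add h, ← Summable.tsum_const_smul]
  · simp only [csmul_of_fst, conjL_wave_csmul]
  · exact (summable_wave_csmul hB τ t).add h

/-- The analogue of `tsum_wave_of_fst` for Fourier integrals. -/
lemma integral_wave_of_fst [CompleteSpace R] [FiniteDimensional ℝ V] [MeasurableSpace V]
    [BorelSpace V] {B : V → Complexified R} (hB : Integrable B) (t : V) :
    ∫ β, wave β t • of (B β).fst =
      (2⁻¹ : ℝ) • ((∫ β, wave β t • B β) + conjL (∫ β, wave β (-t) • B β)) := by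
  have h := conjL.integrable_comp (integrable_wave_csmul hB (-t))
  rw [← conjL.integral_comp_comm (integrable_wave_csmul hB (-t)),
    ← integral_add (integrable_wave_csmul hB t) h, ← integral_smul]
  simp only [csmul_of_fst, conjL_wave_csmul]

lemma csmul_one_re [One R] (q : ℂ) : ((q.re : ℝ) : ℂ) • (1 : Complexified R) =
    (2⁻¹ : ℝ) • (q • 1 + conjL (q • 1)) := by
  ext1
  · simp only [one_def, fst_csmul, fst_smul, fst_add, fst_conjL, snd_of, Complex.ofReal_re]
    module
  · simp [one_def]

end conj

/-- Averaging left inverses at opposite points, when the conjugate of the value at one of the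
points is the value at the other. -/
lemma half_smul_mul_eq_one {S : Type*} [NormedRing S] [NormedAlgebra ℝ S] {v : ℕ}
    {X X' Y Y' : Complexified (CayleyDickson v S)} (h : Y * X = 1) (h' : Y' * X' = 1)
    (hX : conjL X' = X) : ((2⁻¹ : ℝ) • (Y + conjL Y')) * X = 1 := by
  have h1 : conjL Y' * X = 1 := by rw [← hX, ← conjL_mul, h', conjL_one]
  rw [real_smul_mul, add_mul, h, h1]
  module

end Complexified

end realCoefficients

open Complexified

lemma CayleyDickson.character_eq_wave {r : ℕ} (β t : CayleyDickson r ℝ) :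
    character β t = wave β t := by
  simp [character, pairing, wave, PiLp.inner_apply, mul_comm]

theorem mainTheorem8 {S : Type*} [NormedRing S] [NormedAlgebra ℝ S] [NormOneClass S]
    [CompleteSpace S] (v r : ℕ) (hv₂ : 2 ≤ v) (hv₃ : v ≤ 3) (hr : r ≤ v)
    (hR : IsAlternativeMul (CayleyDickson v S)) :
    -- part (1): absolutely convergent almost periodic series
    (∀ (a : ℕ → CayleyDickson v S) (β : ℕ → CayleyDickson r ℝ),
      (Summable fun n => ‖a n‖) →
      (∃ z : CayleyDickson r ℝ → Complexified (CayleyDickson v S),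
        (∀ t, z t * (∑' n, (β n).character t • Complexified.of (a n)) = 1) ∧
        ∃ C : ℝ, ∀ t, ‖z t‖ ≤ C) →
      ∃ (b : ℕ → CayleyDickson v S) (τ : ℕ → CayleyDickson r ℝ),
        (Summable fun n => ‖b n‖) ∧
        ∀ t, (∑' n, (τ n).character t • Complexified.of (b n)) *
          (∑' n, (β n).character t • Complexified.of (a n)) = 1) ∧
    -- part (2): a constant plus the Fourier transform of an integrable function
    (∀ (a : CayleyDickson r ℝ → CayleyDickson v S) (c : ℂ),
      Integrable a volume → c ≠ 0 →
      (∀ t, ∃ z : Complexified (CayleyDickson v S),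
        z * (c • 1 + ∫ β, β.character t • Complexified.of (a β)) = 1) →
      ∃ (q : ℂ) (b : CayleyDickson r ℝ → Complexified (CayleyDickson v S)),
        Integrable b volume ∧
        (c.im = 0 → q.im = 0 ∧ ∀ β, ∃ b₀ : CayleyDickson v S, b β = Complexified.of b₀) ∧
        ∀ t, (q • 1 + ∫ β, β.character t • b β) *
          (c • 1 + ∫ β, β.character t • Complexified.of (a β)) = 1) := by
  have hv : v = 2 ∨ v = 3 := by omega
  simp only [CayleyDickson.character_eq_wave]
  refine ⟨fun a β ha hz => ?_, fun a c ha hc hz => ?_⟩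
  · obtain ⟨z, hz, C, hC⟩ := hz
    have hA : Summable fun n => ‖of (a n)‖ :=
      .of_nonneg_of_le (fun _ => norm_nonneg _) (fun n => norm_of_le (a n)) ha
    obtain ⟨B, τ, hB, h⟩ := exists_series_leftInverse hv hR hA hz hC
    refine ⟨fun n => (B n).fst, τ,
      .of_nonneg_of_le (fun _ => norm_nonneg _) (fun n => norm_fst_le (B n)) hB, fun t => ?_⟩
    rw [tsum_wave_of_fst hB]
    -- since the coefficients `a n` are real, `x(-t)` is the conjugate of `x(t)`
    refine half_smul_mul_eq_one (h t) (h (-t)) ?_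
    rw [conjL.map_tsum (summable_wave_csmul hA β (-t))]
    simp only [conjL_wave_csmul, conjL_of]
  · have hA : Integrable fun β => of (a β) := ofL.integrable_comp ha
    obtain ⟨q, B, hB, h⟩ := exists_integral_leftInverse hv hR hA hc hz
    by_cases hcr : c.im = 0
    · refine ⟨(q.re : ℂ), fun β => of (B β).fst,
        ofL.integrable_comp (fstL.integrable_comp hB),
        fun _ => ⟨Complex.ofReal_im _, fun β => ⟨_, rfl⟩⟩, fun t => ?_⟩
      rw [csmul_one_re, integral_wave_of_fst hB, ← smul_add, add_add_add_comm, ← map_add]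
      refine half_smul_mul_eq_one (h t) (h (-t)) ?_
      rw [map_add, conjL_csmul, conjL_one, Complex.conj_eq_iff_im.2 hcr,
        ← conjL.integral_comp_comm (integrable_wave_csmul hA (-t))]
      simp only [conjL_wave_csmul, conjL_of]
    · exact ⟨q, B, hB, fun h0 => absurd h0 hcr, h⟩
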